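/- Let $(W,S)$ be a Coxeter system with length function $\ell$, let $\bar S$ be the set of $W$-conjugacy classes of elements of $S$ (identify two elements of $S$ when they are conjugate in $W$), let $\mathbb Z[\bar S]$ be the free abelian group on $\bar S$, let $\Gamma$ be a totally ordered abelian group and let $\varphi:\bar S\to\Gamma$ be a map, extended to a group morphism $\varphi:\mathbb Z[\bar S]\to\Gamma$. Write $\mathbb Z[\Gamma]=\bigoplus_\gamma\mathbb Z e^\gamma$ and let $\mathcal H=\mathcal H(W,S,\varphi)$ be the Hecke algebra: the free $\mathbb Z[\Gamma]$-module with basis $(T_w)_{w\in W}$ and the $\mathbb Z[\Gamma]$-bilinear associative multiplication with $T_wT_{w'}=T_{ww'}$ if $\ell(ww')=\ell(w)+\ell(w')$ and $(T_s-e^{\varphi(s)})(T_s+e^{-\varphi(s)})=0$ for $s\in S$. Let $h\mapsto\bar h$ be its antilinear involution with $\overline{e^\gamma}=e^{-\gamma}$, $\overline{T_w}=T_{w^{-1}}^{-1}$, and let $(C_w^\varphi)_{w\in W}$ be the Kazhdan–Lusztig basis: $C_w^\varphi$ is the unique element with $\overline{C_w^\varphi}=C_w^\varphi$ and $C_w^\varphi\equiv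 T_w$ modulo $\bigoplus_{y}\mathbb Z[\Gamma_{<0}]T_y$. For $?\in\{L,R,LR\}$ let $\leq_?^\varphi$ be the transitive closure of the relation "$C_x^\varphi$ has non-zero coefficient in $hC_y^\varphi$ (if $?=L$), in $C_y^\varphi h$ (if $?=R$), in $hC_y^\varphi$ or $C_y^\varphi h$ (if $?=LR$), for some $h\in\mathcal H$" between $x$ and $y$; let $\sim_?^\varphi$ be the associated equivalence relation and $\mathrm{Cell}_?^\varphi(w)=\{x\in W: x\sim_?^\varphi w\}$. For a cell $C$ of $\sim_?^\varphi$ let $$M_C^{?,\varphi}=\Big(\bigoplus_{x\leq_?^\varphi C}\mathbb Z[\Gamma]C_x^\varphi\Big)\Big/\Big(\bigoplus_{x<_?^\varphi C}\mathbb Z[\Gamma]C_x^\varphi\Big),\qquad \mathbb ZM_C^{?,\varphi}=\mathbb Z\otimes_{\mathbb Z[\Gamma]}M_C^{?,\varphi},$$ the tensor product being taken along the augmentation $e^\gamma\mapsto1$. Multiplication by $T_w$ makes $\mathbb ZM_C^{?,\varphi}$ a left $\mathbb ZW$-module if $?=L$, a right $\mathbb ZW$-module if $?=R$ and a $(\mathbb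 ZW,\mathbb ZW)$-bimodule if $?=LR$. A subset $X$ of $\mathbb Z[\bar S]$ is positive if $X\cup(-X)=\mathbb Z[\bar S]$, $X+X\subseteq X$ and $X\cap(-X)$ is a subgroup. For such $X$ let $\Gamma_X=\mathbb Z[\bar S]/(X\cap -X)$, totally ordered by $\gamma\leq_X\gamma'$ if and only if some representative of $\gamma'-\gamma$ lies in $X$, and let $\varphi_X:\bar S\to\Gamma_X$ be the canonical map. An example is $\mathrm{Pos}(\varphi)=\{\lambda\in\mathbb Z[\bar S]:\varphi(\lambda)\geq0\}$. Let $X=\mathrm{Pos}(\varphi)$. Then, for each $?\in\{L,R,LR\}$: (a) the relations $\leq_?^{\varphi}$ and $\leq_?^{\varphi_X}$ are equal, and the relations $\sim_?^{\varphi}$ and $\sim_?^{\varphi_X}$ are equal; (b) $\mathrm{Cell}_?^{\varphi}(w)=\mathrm{Cell}_?^{\varphi_X}(w)$ for all $w\in W$; (c) if $w\in W$ and $C=\mathrm{Cell}_?^{\varphi}(w)$, then $\mathbb ZM_C^{?,\varphi}\simeq\mathbb ZM_C^{?,\varphi_X}$ as left $\mathbb ZW$-modules (if $?=L$), right $\mathbb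 ZW$-modules (if $?=R$), $(\mathbb ZW,\mathbb ZW)$-bimodules (if $?=LR$). Consequently the preorders, the equivalence relations and the cells depend only on $\mathrm{Pos}(\varphi)$: if $\varphi':\bar S\to\Gamma'$ is a map to another totally ordered abelian group with $\mathrm{Pos}(\varphi')=\mathrm{Pos}(\varphi)$, then $\leq_?^{\varphi'}$ equals $\leq_?^{\varphi}$, $\sim_?^{\varphi'}$ equals $\sim_?^{\varphi}$, and $\mathrm{Cell}_?^{\varphi'}(w)=\mathrm{Cell}_?^{\varphi}(w)$ for all $w\in W$. -/

import Mathlib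

open scoped MulOpposite

noncomputable section

namespace KLCells

/-! ## Coxeter groups: the exchange condition for simple reflections -/

section Exchange

variable {B W : Type*} [Group W] {M : CoxeterMatrix B} (cs : CoxeterSystem M W)

open scoped Classical in
def signStep (i : B) : Function.End (W × ZMod 2) := fun p =>
  (cs.simple i * p.1 * cs.simple i, p.2 + if p.1 = cs.simple i then 1 else 0)

open scoped Classical in
theorem signStep_prod (ω : List B) (p : W × ZMod 2) :
    (ω.map (signStep cs)).prod p =
      (cs.wordProd ω * p.1 * (cs.wordProd ω)⁻¹,
        p.2 + ((cs.rightInvSeq ω).count p.1 : ZMod 2)) := by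
  induction ω with
  | nil => simp [Function.End.one_def]
  | cons i ω ih =>
    rw [List.map_cons, List.prod_cons]
    change signStep cs i ((ω.map (signStep cs)).prod p) = _
    rw [ih]
    have h : (cs.wordProd ω * p.1 * (cs.wordProd ω)⁻¹ = cs.simple i) ↔
        (cs.wordProd ω)⁻¹ * cs.simple i * cs.wordProd ω = p.1 := by
      constructor
      · intro h; rw [← h]; group
      · intro h; rw [← h]; group
    simp only [mul_assoc] at h
    simp only [signStep, cs.wordProd_cons, CoxeterSystem.rightInvSeq, List.count_cons, h,
      mul_inv_rev, cs.inv_simple, mul_assoc, beq_iff_eq, Nat.cast_add, add_assoc,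
      Nat.cast_ite, Nat.cast_one, Nat.cast_zero]

theorem alternatingWord_flatten (i j : B) (m : ℕ) :
    CoxeterSystem.alternatingWord i j (2 * m) = (List.replicate m [i, j]).flatten := by
  induction m with
  | zero => rfl
  | succ m ih =>
    rw [show 2 * (m + 1) = 2 * m + 1 + 1 by ring, CoxeterSystem.alternatingWord_succ',
      CoxeterSystem.alternatingWord_succ', ih]
    simp [List.replicate_succ]

open scoped Classical in
theorem signStep_liftable : M.IsLiftable (signStep cs) := by
  intro i j
  set m := M i j with hm
  set ω := CoxeterSystem.alternatingWord i j (2 * m) with hω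
  have h1 : (signStep cs i * signStep cs j) ^ m = (ω.map (signStep cs)).prod := by
    rw [hω, alternatingWord_flatten, List.map_flatten, List.prod_flatten]
    simp
  have hp : cs.wordProd ω = 1 := by
    rw [hω, cs.prod_alternatingWord_eq_mul_pow]
    simp [hm]
  have hcount : ∀ t, (((cs.rightInvSeq ω).count t : ℕ) : ZMod 2) = 0 := by
    intro t
    have hrev : ω.reverse = CoxeterSystem.alternatingWord j i (2 * m) := by
      rw [hω, alternatingWord_flatten, alternatingWord_flatten, List.reverse_flatten]
      simp
    have hr : (cs.rightInvSeq ω).count t = (cs.leftInvSeq ω.reverse).count t := by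
      rw [cs.leftInvSeq_reverse, List.count_reverse]
    rw [hr, hrev]
    set L := cs.leftInvSeq (CoxeterSystem.alternatingWord j i (2 * m)) with hL
    have hlen : L.length = 2 * m := by simp [hL]
    have hhalf : L.drop m = L.take m := by
      apply List.ext_getElem
      · simp [hlen]; omega
      · intro k h1 h2
        simp only [List.length_drop, hlen] at h1
        rw [List.getElem_drop, List.getElem_take]
        simp only [hL]
        rw [cs.getElem_leftInvSeq_alternatingWord j i m (m + k) (by omega),
          cs.getElem_leftInvSeq_alternatingWord j i m k (by omega),
          cs.prod_alternatingWord_eq_mul_pow, cs.prod_alternatingWord_eq_mul_pow]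
        have e1 : (2 * (m + k) + 1) / 2 = m + k := by omega
        have e2 : (2 * k + 1) / 2 = k := by omega
        rw [e1, e2, pow_add, hm, cs.simple_mul_simple_pow, one_mul]
        simp
    rw [← List.take_append_drop m L, hhalf, List.count_append, Nat.cast_add]
    exact CharTwo.add_self_eq_zero _
  rw [h1]
  funext p
  rw [signStep_prod, hp, hcount]
  simp [Function.End.one_def]

/-- If `w = π ω` and `ℓ(w s) < ℓ(w)`, then `s` occurs in the right inversion
sequence of `ω`. -/
theorem mem_rightInvSeq_of_isRightDescent {ω : List B} {j : B}
    (h : cs.length (cs.wordProd ω * cs.simple j) < cs.length (cs.wordProd ω)) :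
    cs.simple j ∈ cs.rightInvSeq ω := by
  classical
  obtain ⟨ω', hr', hw'⟩ := cs.exists_isReduced (cs.wordProd ω * cs.simple j)
  have hw : cs.wordProd (ω'.concat j) = cs.wordProd ω := by
    rw [cs.wordProd_concat, ← hw', mul_assoc, cs.simple_mul_simple_self, mul_one]
  have hred : cs.IsReduced (ω'.concat j) := by
    have h1 := hr'.eq
    rw [← hw'] at h1
    have h2 := cs.length_mul_simple (cs.wordProd ω) j
    unfold CoxeterSystem.IsReduced
    rw [hw, List.length_concat]
    omega
  have key : ∀ ω₁ ω₂ : List B, cs.wordProd ω₁ = cs.wordProd ω₂ →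
      (((cs.rightInvSeq ω₁).count (cs.simple j) : ℕ) : ZMod 2) =
        ((cs.rightInvSeq ω₂).count (cs.simple j) : ℕ) := by
    intro ω₁ ω₂ h12
    have hl : ∀ ω : List B, cs.lift ⟨signStep cs, signStep_liftable cs⟩ (cs.wordProd ω) =
        (ω.map (signStep cs)).prod := by
      intro ω
      rw [CoxeterSystem.wordProd, map_list_prod, List.map_map]
      congr 1
      apply List.map_congr_left
      intro i _
      simp
    have h3 := congrArg (fun f : Function.End (W × ZMod 2) => (f (cs.simple j, 0)).2)
      ((hl ω₁).symm.trans ((congrArg _ h12).trans (hl ω₂)))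
    simpa [signStep_prod] using h3
  have h1 : (cs.rightInvSeq (ω'.concat j)).count (cs.simple j) = 1 := by
    apply List.count_eq_one_of_mem hred.nodup_rightInvSeq
    rw [cs.rightInvSeq_concat]
    simp
  have h2 := key _ _ hw
  rw [h1] at h2
  by_contra hn
  rw [List.count_eq_zero_of_not_mem hn] at h2
  simp at h2

theorem exchange_up {w : W} {i j : B}
    (h1 : cs.length w < cs.length (cs.simple i * w))
    (h2 : cs.length w < cs.length (w * cs.simple j))
    (h3 : cs.length (cs.simple i * w * cs.simple j) < cs.length (cs.simple i * w)) :
    cs.simple i * w = w * cs.simple j := by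
  obtain ⟨ω, hr, rfl⟩ := cs.exists_isReduced w
  have hred : cs.IsReduced (i :: ω) := by
    have := cs.length_simple_mul (cs.wordProd ω) i
    have := hr.eq
    unfold CoxeterSystem.IsReduced
    rw [cs.wordProd_cons, List.length_cons]
    omega
  rw [← cs.wordProd_cons] at h3
  have hm := mem_rightInvSeq_of_isRightDescent cs h3
  rw [CoxeterSystem.rightInvSeq, List.mem_cons] at hm
  rcases hm with hm | hm
  · rw [hm]; group
  · have := (cs.isRightInversion_of_mem_rightInvSeq hr hm).2
    omega

theorem exchange_iff {w : W} {i j : B} (h : cs.simple i * w ≠ w * cs.simple j) :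
    (cs.length (cs.simple i * w * cs.simple j) < cs.length (cs.simple i * w) ↔
        cs.length (w * cs.simple j) < cs.length w) ∧
      (cs.length (cs.simple i * w * cs.simple j) < cs.length (w * cs.simple j) ↔
        cs.length (cs.simple i * w) < cs.length w) := by
  have e1 := cs.length_simple_mul w i
  have e2 := cs.length_mul_simple w j
  have e3 := cs.length_mul_simple (cs.simple i * w) j
  have e4 := cs.length_simple_mul (w * cs.simple j) i
  rw [← mul_assoc] at e4
  have k1 := exchange_up cs (w := w) (i := i) (j := j)
  have k2 := exchange_up cs (w := cs.simple i * w) (i := i) (j := j)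
  rw [cs.simple_mul_simple_cancel_left] at k2
  have k3 : ¬ (w = cs.simple i * w * cs.simple j) := by
    intro hh
    apply h
    conv_rhs => rw [hh]
    rw [cs.simple_mul_simple_cancel_right]
  have k1' := fun a b c => h (k1 a b c)
  have k2' := fun a b c => k3 (k2 a b c)
  constructor <;> constructor <;> intro hh <;> by_contra hc
  all_goals
    first
      | exact k1' (by omega) (by omega) (by omega)
      | exact k2' (by omega) (by omega) (by omega)

end Exchange

/-! ## Iwahori-Hecke algebras -/

section SBar

variable {B W : Type*} [Group W] {M : CoxeterMatrix B}

/-- Two simple reflections are identified when they are conjugate in `W`. -/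
def simpleConj (cs : CoxeterSystem M W) : Setoid B where
  r i j := IsConj (cs.simple i) (cs.simple j)
  iseqv := ⟨fun _ => IsConj.refl _, IsConj.symm, IsConj.trans⟩

/-- The set `S̄` of conjugacy classes of simple reflections. -/
def SBar (cs : CoxeterSystem M W) : Type _ := Quotient (simpleConj cs)

/-- The class in `S̄` of a simple reflection. -/
def toSBar (cs : CoxeterSystem M W) (i : B) : SBar cs := Quotient.mk (simpleConj cs) i

theorem toSBar_eq (cs : CoxeterSystem M W) {i j : B} (h : IsConj (cs.simple i) (cs.simple j)) :
    toSBar cs i = toSBar cs j := Quotient.sound h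

end SBar

section Hecke

variable {B W : Type*} [Group W] {M : CoxeterMatrix B} {A : Type*} [CommRing A]

/-- The Iwahori-Hecke algebra over a commutative ring `A`, in normalised form: the free
`A`-module with basis `(T_w)` and multiplication such that `T_w T_{w'} = T_{ww'}` whenever
`ℓ(ww') = ℓ(w) + ℓ(w')` and `T_s ^ 2 = 1 + u(s) T_s`
(see `GHecke.T_mul_T` and `GHecke.T_simple_sq` below). -/
@[nolint unusedArguments]
def GHecke (cs : CoxeterSystem M W) (_u : SBar cs → A) : Type _ := W →₀ A

namespace GHecke

variable (cs : CoxeterSystem M W) (u : SBar cs → A)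

instance : AddCommGroup (GHecke cs u) := inferInstanceAs (AddCommGroup (W →₀ A))
instance : Module A (GHecke cs u) := inferInstanceAs (Module A (W →₀ A))

/-- The standard basis `(T_w)`. -/
def basis : Module.Basis W A (GHecke cs u) := Module.Basis.ofRepr (LinearEquiv.refl A (W →₀ A))

/-- The standard basis element `T_w`. -/
def T (w : W) : GHecke cs u := basis cs u w

open scoped Classical in
/-- Left multiplication by `T_s`. -/
def lop (i : B) : GHecke cs u →ₗ[A] GHecke cs u :=
  (basis cs u).constr A fun w => T cs u (cs.simple i * w) +
    (if cs.length (cs.simple i * w) < cs.length w then u (toSBar cs i) else 0) • T cs u w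

open scoped Classical in
/-- Right multiplication by `T_s`. -/
def rop (i : B) : GHecke cs u →ₗ[A] GHecke cs u :=
  (basis cs u).constr A fun w => T cs u (w * cs.simple i) +
    (if cs.length (w * cs.simple i) < cs.length w then u (toSBar cs i) else 0) • T cs u w

theorem lop_T (i : B) (w : W) : lop cs u i (T cs u w) = T cs u (cs.simple i * w) +
    (if cs.length (cs.simple i * w) < cs.length w then u (toSBar cs i) else 0) • T cs u w := by
  simp [lop, T, Module.Basis.constr_basis]

theorem rop_T (i : B) (w : W) : rop cs u i (T cs u w) = T cs u (w * cs.simple i) +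
    (if cs.length (w * cs.simple i) < cs.length w then u (toSBar cs i) else 0) • T cs u w := by
  simp [rop, T, Module.Basis.constr_basis]

theorem lop_rop (i j : B) : lop cs u i * rop cs u j = rop cs u j * lop cs u i := by
  apply (basis cs u).ext
  intro w
  change lop cs u i (rop cs u j (T cs u w)) = rop cs u j (lop cs u i (T cs u w))
  rw [rop_T, lop_T, map_add, map_add, map_smul, map_smul, lop_T, rop_T, lop_T, rop_T]
  by_cases h : cs.simple i * w = w * cs.simple j
  · have hc : toSBar cs i = toSBar cs j := by
      apply toSBar_eq
      rw [isConj_iff]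
      refine ⟨w⁻¹, ?_⟩
      rw [inv_inv, mul_assoc, h, inv_mul_cancel_left]
    have h' : cs.simple i * (w * cs.simple j) = w := by
      rw [← h, cs.simple_mul_simple_cancel_left]
    have h'' : w * cs.simple j * cs.simple j = w := cs.simple_mul_simple_cancel_right j
    rw [h, h', h'', hc]
  · obtain ⟨h1, h2⟩ := exchange_iff cs h
    rw [← mul_assoc]
    simp only [h1, h2]
    simp only [smul_add, smul_smul, mul_comm]
    abel

theorem lop_iter (ω : List B) (h : cs.IsReduced ω) :
    (ω.map (lop cs u)).prod (T cs u 1) = T cs u (cs.wordProd ω) := by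
  induction ω with
  | nil => simp
  | cons i ω ih =>
    have hr : cs.IsReduced ω := by simpa using h.drop 1
    have h1 := h.eq
    have h2 := hr.eq
    rw [cs.wordProd_cons, List.length_cons] at h1
    rw [List.map_cons, List.prod_cons, Module.End.mul_apply, ih hr, lop_T, if_neg (by omega),
      cs.wordProd_cons, zero_smul, add_zero]

theorem rop_iter (w : W) : ∃ f ∈ Submonoid.closure (Set.range (rop cs u)),
    f (T cs u 1) = T cs u w := by
  generalize hn : cs.length w = n
  induction n generalizing w with
  | zero =>
    rw [cs.length_eq_zero_iff] at hn
    exact ⟨1, one_mem _, by simp [hn]⟩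
  | succ n ih =>
    obtain ⟨i, hi⟩ := cs.exists_rightDescent_of_ne_one (w := w)
      (by rw [Ne, ← cs.length_eq_zero_iff]; omega)
    rw [cs.isRightDescent_iff] at hi
    obtain ⟨f, hf, h⟩ := ih (w * cs.simple i) (by omega)
    refine ⟨rop cs u i * f, mul_mem (Submonoid.subset_closure ⟨i, rfl⟩) hf, ?_⟩
    rw [Module.End.mul_apply, h, rop_T, cs.simple_mul_simple_cancel_right, if_neg (by omega),
      zero_smul, add_zero]

/-- Endomorphisms commuting with all right multiplications by `T_s`. -/
def comm : Subalgebra A (Module.End A (GHecke cs u)) :=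
  Subalgebra.centralizer A (Set.range (rop cs u))

theorem lop_mem (i : B) : lop cs u i ∈ comm cs u := by
  rw [comm, Subalgebra.mem_centralizer_iff]
  rintro _ ⟨j, rfl⟩
  exact (lop_rop cs u i j).symm

theorem comm_closure {f g : Module.End A (GHecke cs u)} (hf : f ∈ comm cs u)
    (hg : g ∈ Submonoid.closure (Set.range (rop cs u))) : g * f = f * g := by
  induction hg using Submonoid.closure_induction with
  | mem x hx => exact (Subalgebra.mem_centralizer_iff A).1 hf x hx
  | one => simp
  | mul x y _ _ hx hy => rw [mul_assoc, hy, ← mul_assoc, hx, mul_assoc]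

/-- Evaluation at `T_1`. -/
def evalOne : comm cs u →ₗ[A] GHecke cs u :=
  (LinearMap.applyₗ (T cs u 1)).comp (comm cs u).val.toLinearMap

theorem evalOne_apply (f : comm cs u) : evalOne cs u f = f.1 (T cs u 1) := rfl

theorem evalOne_bijective : Function.Bijective (evalOne cs u) := by
  constructor
  · rw [← LinearMap.ker_eq_bot, LinearMap.ker_eq_bot']
    intro f hf
    apply Subtype.ext
    apply (basis cs u).ext
    intro w
    obtain ⟨g, hg, h⟩ := rop_iter cs u w
    change f.1 (T cs u w) = 0
    rw [← h, ← Module.End.mul_apply, ← comm_closure cs u f.2 hg, Module.End.mul_apply,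
      ← evalOne_apply, hf, map_zero]
  · rw [← LinearMap.range_eq_top, eq_top_iff, ← (basis cs u).span_eq, Submodule.span_le]
    rintro _ ⟨w, rfl⟩
    obtain ⟨ω, hr, rfl⟩ := cs.exists_isReduced w
    refine ⟨⟨(ω.map (lop cs u)).prod, ?_⟩, lop_iter cs u ω hr⟩
    apply list_prod_mem
    simp only [List.mem_map]
    rintro _ ⟨i, _, rfl⟩
    exact lop_mem cs u i

/-- An element `h` corresponds to the operator of left multiplication by `h`. -/
def equivComm : comm cs u ≃ₗ[A] GHecke cs u :=
  LinearEquiv.ofBijective (evalOne cs u) (evalOne_bijective cs u)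

/-- Left multiplication by `h`. -/
def mulOp (h : GHecke cs u) : Module.End A (GHecke cs u) := ((equivComm cs u).symm h).1

theorem mulOp_T_one (h : GHecke cs u) : mulOp cs u h (T cs u 1) = h :=
  (equivComm cs u).apply_symm_apply h

theorem mulOp_unique {f : Module.End A (GHecke cs u)} (hf : f ∈ comm cs u) :
    mulOp cs u (f (T cs u 1)) = f := by
  have : (equivComm cs u).symm (f (T cs u 1)) = ⟨f, hf⟩ := by
    rw [LinearEquiv.symm_apply_eq]; rfl
  rw [mulOp, this]

theorem mulOp_mem (h : GHecke cs u) : mulOp cs u h ∈ comm cs u := ((equivComm cs u).symm h).2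

theorem mulOp_mulOp (x y : GHecke cs u) :
    mulOp cs u (mulOp cs u x y) = mulOp cs u x * mulOp cs u y := by
  have := mulOp_unique cs u (mul_mem (mulOp_mem cs u x) (mulOp_mem cs u y))
  rwa [Module.End.mul_apply, mulOp_T_one] at this

theorem mulOp_add (x y : GHecke cs u) : mulOp cs u (x + y) = mulOp cs u x + mulOp cs u y := by
  simp [mulOp]

theorem mulOp_smul (a : A) (x : GHecke cs u) : mulOp cs u (a • x) = a • mulOp cs u x := by
  simp [mulOp]

theorem mulOp_one : mulOp cs u (T cs u 1) = 1 := by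
  simpa using mulOp_unique cs u (one_mem (comm cs u))

instance : Ring (GHecke cs u) :=
  { (inferInstance : AddCommGroup (GHecke cs u)) with
    mul := fun x y => mulOp cs u x y
    one := T cs u 1
    mul_assoc := fun x y z => by
      change mulOp cs u (mulOp cs u x y) z = mulOp cs u x (mulOp cs u y z)
      rw [mulOp_mulOp]; rfl
    one_mul := fun x => by
      change mulOp cs u (T cs u 1) x = x
      rw [mulOp_one]; rfl
    mul_one := fun x => mulOp_T_one cs u x
    left_distrib := fun x y z => map_add (mulOp cs u x) y z
    right_distrib := fun x y z => by
      change mulOp cs u (x + y) z = mulOp cs u x z + mulOp cs u y z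
      rw [mulOp_add]; rfl
    zero_mul := fun x => by
      change mulOp cs u 0 x = 0
      simp [mulOp]
    mul_zero := fun x => map_zero (mulOp cs u x) }

theorem mul_def (x y : GHecke cs u) : x * y = mulOp cs u x y := rfl

theorem one_def : (1 : GHecke cs u) = T cs u 1 := rfl

instance : Algebra A (GHecke cs u) :=
  Algebra.ofModule
    (fun a x y => by rw [mul_def, mulOp_smul]; rfl)
    (fun a x y => by rw [mul_def, map_smul]; rfl)

theorem mulOp_simple (i : B) : mulOp cs u (T cs u (cs.simple i)) = lop cs u i := by
  have h := mulOp_unique cs u (lop_mem cs u i)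
  rwa [lop_T, mul_one, if_neg (by simp), zero_smul, add_zero] at h

theorem T_simple_mul (i : B) (x : GHecke cs u) : T cs u (cs.simple i) * x = lop cs u i x := by
  rw [mul_def, mulOp_simple]

theorem mul_T_simple (i : B) (x : GHecke cs u) : x * T cs u (cs.simple i) = rop cs u i x := by
  have h : rop cs u i (T cs u 1) = T cs u (cs.simple i) := by
    rw [rop_T, one_mul, if_neg (by simp), zero_smul, add_zero]
  rw [← h, mul_def]
  have h2 := (Subalgebra.mem_centralizer_iff A).1 (mulOp_mem cs u x) _ ⟨i, rfl⟩
  have h3 := LinearMap.congr_fun h2 (T cs u 1)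
  simp only [Module.End.mul_apply, mulOp_T_one] at h3
  exact h3.symm

theorem T_one : T cs u 1 = 1 := rfl

theorem T_simple_mul_T (i : B) (w : W) : T cs u (cs.simple i) * T cs u w =
    T cs u (cs.simple i * w) +
    (if cs.length (cs.simple i * w) < cs.length w then u (toSBar cs i) else 0) • T cs u w := by
  rw [T_simple_mul, lop_T]

theorem T_simple_mul_T_of_lt {i : B} {w : W} (h : cs.length w < cs.length (cs.simple i * w)) :
    T cs u (cs.simple i) * T cs u w = T cs u (cs.simple i * w) := by
  rw [T_simple_mul_T, if_neg (by omega), zero_smul, add_zero]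

theorem T_simple_sq (i : B) :
    T cs u (cs.simple i) * T cs u (cs.simple i) = 1 + u (toSBar cs i) • T cs u (cs.simple i) := by
  rw [T_simple_mul_T, cs.simple_mul_simple_self, if_pos (by simp)]; rfl

theorem T_mul_T (x y : W) (h : cs.length (x * y) = cs.length x + cs.length y) :
    T cs u x * T cs u y = T cs u (x * y) := by
  generalize hn : cs.length x = n
  induction n generalizing x with
  | zero =>
    rw [cs.length_eq_zero_iff] at hn
    simp [hn, T_one]
  | succ n ih =>
    obtain ⟨i, hi⟩ := cs.exists_leftDescent_of_ne_one (w := x)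
      (by rw [Ne, ← cs.length_eq_zero_iff]; omega)
    rw [cs.isLeftDescent_iff] at hi
    have e1 := cs.length_mul_le (cs.simple i * x) y
    have e2 := cs.length_simple_mul (x * y) i
    rw [← mul_assoc] at e2
    have h1 := ih (cs.simple i * x) (by omega) (by omega)
    have h2 : T cs u (cs.simple i) * T cs u (cs.simple i * x) = T cs u x := by
      rw [T_simple_mul_T_of_lt, cs.simple_mul_simple_cancel_left]
      rw [cs.simple_mul_simple_cancel_left]; omega
    rw [← h2, mul_assoc, h1, mul_assoc, T_simple_mul_T_of_lt, cs.simple_mul_simple_cancel_left]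
    rw [cs.simple_mul_simple_cancel_left, ← mul_assoc]; omega

end GHecke

end Hecke

/-! ## Kazhdan-Lusztig bases -/

section KL

variable {B W : Type*} [Group W] {M : CoxeterMatrix B} {Γ : Type*} [AddCommGroup Γ]

/-- The element `e^γ` of the group ring `ℤ[Γ]`. -/
def expo (γ : Γ) : AddMonoidAlgebra ℤ Γ := AddMonoidAlgebra.single γ 1

theorem expo_mul_expo (γ δ : Γ) : expo γ * expo δ = expo (γ + δ) := by
  simp [expo, AddMonoidAlgebra.single_mul_single]

theorem expo_zero : expo (0 : Γ) = 1 := rfl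

/-- The involution `e^γ ↦ e^(-γ)` of `ℤ[Γ]`. -/
def conj : AddMonoidAlgebra ℤ Γ →+* AddMonoidAlgebra ℤ Γ :=
  AddMonoidAlgebra.mapDomainRingHom ℤ (negAddMonoidHom : Γ →+ Γ)

theorem conj_single (γ : Γ) (n : ℤ) :
    conj (AddMonoidAlgebra.single γ n) = AddMonoidAlgebra.single (-γ) n := by
  simp [conj]

theorem conj_expo (γ : Γ) : conj (expo γ) = expo (-γ) := conj_single γ 1

/-- The Hecke algebra of `(W, S)` over `ℤ[Γ]` with parameter `φ : S̄ → Γ`: free with basis `(T_w)`,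
with `T_w T_{w'} = T_{ww'}` if `ℓ(ww') = ℓ(w) + ℓ(w')` (`GHecke.T_mul_T`) and
`(T_s - e^{φ(s)}) (T_s + e^{-φ(s)}) = 0` (`Hecke.quadratic`). -/
abbrev Hecke (cs : CoxeterSystem M W) (φ : SBar cs → Γ) : Type _ :=
  GHecke cs (fun ω => expo (φ ω) - expo (-φ ω))

namespace Hecke

variable (cs : CoxeterSystem M W) (φ : SBar cs → Γ)

/-- The standard basis of the Hecke algebra. -/
abbrev stdBasis : Module.Basis W (AddMonoidAlgebra ℤ Γ) (Hecke cs φ) := GHecke.basis cs _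

/-- The standard basis element `T_w`. -/
abbrev T (w : W) : Hecke cs φ := GHecke.T cs _ w

theorem stdBasis_apply (w : W) : stdBasis cs φ w = T cs φ w := rfl

theorem T_one : T cs φ 1 = 1 := rfl

theorem quadratic (i : B) :
    (T cs φ (cs.simple i) - algebraMap _ _ (expo (φ (toSBar cs i)))) *
      (T cs φ (cs.simple i) + algebraMap _ _ (expo (-φ (toSBar cs i)))) = 0 := by
  have h := GHecke.T_simple_sq cs (fun ω => expo (φ ω) - expo (-φ ω)) i
  rw [mul_add, sub_mul, sub_mul, h, ← map_mul, expo_mul_expo, add_neg_cancel, expo_zero, map_one,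
    ← Algebra.smul_def, ← Algebra.commutes, ← Algebra.smul_def, sub_smul]
  abel

theorem T_simple_inv (i : B) :
    T cs φ (cs.simple i) * (T cs φ (cs.simple i) -
      algebraMap _ _ (expo (φ (toSBar cs i)) - expo (-φ (toSBar cs i)))) = 1 ∧
    (T cs φ (cs.simple i) -
      algebraMap _ _ (expo (φ (toSBar cs i)) - expo (-φ (toSBar cs i)))) *
        T cs φ (cs.simple i) = 1 := by
  have h := GHecke.T_simple_sq cs (fun ω => expo (φ ω) - expo (-φ ω)) i
  constructor
  · rw [mul_sub, h, ← Algebra.commutes, ← Algebra.smul_def]; abel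
  · rw [sub_mul, h, ← Algebra.smul_def]; abel

theorem isUnit_T (w : W) : IsUnit (T cs φ w) := by
  generalize hn : cs.length w = n
  induction n generalizing w with
  | zero =>
    rw [cs.length_eq_zero_iff] at hn
    rw [hn]; exact isUnit_one
  | succ n ih =>
    obtain ⟨i, hi⟩ := cs.exists_leftDescent_of_ne_one (w := w)
      (by rw [Ne, ← cs.length_eq_zero_iff]; omega)
    rw [cs.isLeftDescent_iff] at hi
    have h2 : T cs φ (cs.simple i) * T cs φ (cs.simple i * w) = T cs φ w := by
      rw [GHecke.T_simple_mul_T_of_lt, cs.simple_mul_simple_cancel_left]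
      rw [cs.simple_mul_simple_cancel_left]; omega
    rw [← h2]
    have h3 := T_simple_inv cs φ i
    exact IsUnit.mul ⟨⟨_, _, h3.1, h3.2⟩, rfl⟩ (ih _ (by omega))

/-- The bar involution: `ℤ[Γ]`-antilinear, with `T_w ↦ T_{w⁻¹}⁻¹` (the elements `T_w` are
invertible by `isUnit_T`). -/
def bar (h : Hecke cs φ) : Hecke cs φ :=
  ((stdBasis cs φ).repr h).sum fun w a => conj a • Ring.inverse (T cs φ w⁻¹)

theorem bar_add (x y : Hecke cs φ) : bar cs φ (x + y) = bar cs φ x + bar cs φ y := by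
  rw [bar, map_add, Finsupp.sum_add_index']
  · rfl
  · simp
  · intro w a b; rw [map_add, add_smul]

/-- The bar involution as a morphism of additive groups. -/
def barHom : Hecke cs φ →+ Hecke cs φ := AddMonoidHom.mk' (bar cs φ) (bar_add cs φ)

theorem bar_smul (a : AddMonoidAlgebra ℤ Γ) (x : Hecke cs φ) :
    bar cs φ (a • x) = conj a • bar cs φ x := by
  rw [bar, map_smul, Finsupp.sum_smul_index (by simp), bar, Finsupp.smul_sum]
  apply Finsupp.sum_congr
  intro w _
  rw [map_mul, mul_smul]

theorem bar_T (w : W) : bar cs φ (T cs φ w) = Ring.inverse (T cs φ w⁻¹) := by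
  rw [bar, ← stdBasis_apply, Module.Basis.repr_self, Finsupp.sum_single_index (by simp)]
  simp

theorem bar_zero : bar cs φ 0 = 0 := map_zero (barHom cs φ)

theorem bar_sub (x y : Hecke cs φ) : bar cs φ (x - y) = bar cs φ x - bar cs φ y :=
  map_sub (barHom cs φ) x y

theorem bar_T_simple (i : B) : bar cs φ (T cs φ (cs.simple i)) =
    T cs φ (cs.simple i) - algebraMap _ _ (expo (φ (toSBar cs i)) - expo (-φ (toSBar cs i))) := by
  rw [bar_T, cs.inv_simple]
  have h3 := T_simple_inv cs φ i
  exact Ring.inverse_unit ⟨_, _, h3.1, h3.2⟩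

theorem bar_T_of_lt {i : B} {w : W} (h : cs.length w < cs.length (cs.simple i * w)) :
    bar cs φ (T cs φ (cs.simple i * w)) = bar cs φ (T cs φ (cs.simple i)) * bar cs φ (T cs φ w) := by
  rw [bar_T, bar_T, bar_T, cs.inv_simple, mul_inv_rev, cs.inv_simple]
  have h1 : T cs φ (w⁻¹ * cs.simple i) = T cs φ w⁻¹ * T cs φ (cs.simple i) := by
    rw [GHecke.T_mul_T]
    rw [cs.length_inv, cs.length_simple, ← cs.length_inv, mul_inv_rev, inv_inv, cs.inv_simple]
    have := cs.length_simple_mul w i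
    omega
  rw [h1]
  obtain ⟨a, ha⟩ := isUnit_T cs φ w⁻¹
  obtain ⟨b, hb⟩ := isUnit_T cs φ (cs.simple i)
  rw [← ha, ← hb, ← Units.val_mul, Ring.inverse_unit, Ring.inverse_unit, Ring.inverse_unit,
    mul_inv_rev, Units.val_mul]

/-- An additive map equality can be checked on multiples of the `T_w`. -/
theorem induct {p : Hecke cs φ → Prop} (h : Hecke cs φ) (h0 : p 0)
    (hadd : ∀ x y, p x → p y → p (x + y))
    (hT : ∀ w, (stdBasis cs φ).repr h w ≠ 0 →
      ∀ a : AddMonoidAlgebra ℤ Γ, p (a • T cs φ w)) : p h := by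
  rw [← (stdBasis cs φ).linearCombination_repr h, Finsupp.linearCombination_apply, Finsupp.sum]
  have : ∀ s : Finset W, s ⊆ ((stdBasis cs φ).repr h).support →
      p (∑ w ∈ s, (stdBasis cs φ).repr h w • stdBasis cs φ w) := by
    classical
    intro s
    induction s using Finset.induction_on with
    | empty => intro _; simpa using h0
    | insert w s hw ih =>
      intro hs
      rw [Finset.sum_insert hw]
      exact hadd _ _ (hT w (Finsupp.mem_support_iff.1 (hs (Finset.mem_insert_self w s))) _)
        (ih fun x hx => hs (Finset.mem_insert_of_mem hx))
  exact this _ (Finset.Subset.refl _)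

theorem conj_u (i : B) : conj (expo (φ (toSBar cs i)) - expo (-φ (toSBar cs i))) =
    -(expo (φ (toSBar cs i)) - expo (-φ (toSBar cs i))) := by
  rw [map_sub, conj_expo, conj_expo, neg_neg, neg_sub]

theorem bar_T_simple_mul (i : B) (h : Hecke cs φ) :
    bar cs φ (T cs φ (cs.simple i) * h) = bar cs φ (T cs φ (cs.simple i)) * bar cs φ h := by
  induction h using induct with
  | h0 => rw [mul_zero, bar_zero, mul_zero]
  | hadd x y hx hy => rw [mul_add, bar_add, bar_add, mul_add, hx, hy]
  | hT w _ a =>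
    rw [mul_smul_comm, bar_smul, bar_smul, mul_smul_comm]
    congr 1
    rcases cs.length_simple_mul w i with h | h
    · rw [GHecke.T_simple_mul_T_of_lt _ _ (by omega), bar_T_of_lt _ _ (by omega)]
    · have h1 := bar_T_of_lt cs φ (i := i) (w := cs.simple i * w)
        (by rw [cs.simple_mul_simple_cancel_left]; omega)
      rw [cs.simple_mul_simple_cancel_left] at h1
      rw [GHecke.T_simple_mul_T, if_pos (by omega), bar_add, bar_smul, conj_u, h1]
      set b := bar cs φ (T cs φ (cs.simple i * w))
      set u := expo (φ (toSBar cs i)) - expo (-φ (toSBar cs i)) with hu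
      have h2 := T_simple_inv cs φ i
      rw [← bar_T_simple] at h2
      have h3 : bar cs φ (T cs φ (cs.simple i)) * bar cs φ (T cs φ (cs.simple i)) =
          1 - u • bar cs φ (T cs φ (cs.simple i)) := by
        conv_lhs => rw [bar_T_simple, ← hu]; rhs; rw [← bar_T_simple]
        rw [sub_mul, h2.1, Algebra.smul_def]
      rw [← mul_assoc, h3, sub_mul, one_mul, neg_smul, smul_mul_assoc]
      abel

/-- The span of the `T_w` with `ℓ(w) < n`. -/
def low (n : ℕ) : Submodule (AddMonoidAlgebra ℤ Γ) (Hecke cs φ) where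
  carrier := {h | ∀ w, n ≤ cs.length w → (stdBasis cs φ).repr h w = 0}
  add_mem' := fun {x y} hx hy w hw => by rw [map_add, Finsupp.add_apply, hx w hw, hy w hw, add_zero]
  zero_mem' := fun w _ => by simp
  smul_mem' := fun a x hx w hw => by rw [map_smul, Finsupp.smul_apply, hx w hw, smul_zero]

theorem T_mem_low {w : W} {n : ℕ} (h : cs.length w < n) : T cs φ w ∈ low cs φ n := by
  classical
  intro y hy
  rw [← stdBasis_apply, Module.Basis.repr_self, Finsupp.single_apply, if_neg]
  rintro rfl
  omega

theorem low_mono {m n : ℕ} (h : m ≤ n) : low cs φ m ≤ low cs φ n :=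
  fun _ hx w hw => hx w (h.trans hw)

theorem low_induct {p : Hecke cs φ → Prop} {n : ℕ} {h : Hecke cs φ} (hh : h ∈ low cs φ n) (h0 : p 0)
    (hadd : ∀ x y, p x → p y → p (x + y))
    (hT : ∀ w, cs.length w < n → ∀ a : AddMonoidAlgebra ℤ Γ, p (a • T cs φ w)) : p h := by
  refine induct cs φ h h0 hadd fun w hw a => hT w ?_ a
  by_contra hc
  exact hw (hh w (by omega))

theorem simple_mul_low (i : B) {n : ℕ} {h : Hecke cs φ} (hh : h ∈ low cs φ n) :
    T cs φ (cs.simple i) * h ∈ low cs φ (n + 1) := by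
  refine low_induct cs φ (p := fun h => T cs φ (cs.simple i) * h ∈ low cs φ (n + 1)) hh
    (by simp) (fun x y hx hy => ?_) fun w hw a => ?_
  · rw [mul_add]; exact add_mem hx hy
  · rw [mul_smul_comm, GHecke.T_simple_mul_T]
    have := cs.length_simple_mul w i
    exact Submodule.smul_mem _ _ (add_mem (T_mem_low _ _ (by omega))
      (Submodule.smul_mem _ _ (T_mem_low _ _ (by omega))))

theorem bar_T_sub_mem (w : W) : bar cs φ (T cs φ w) - T cs φ w ∈ low cs φ (cs.length w) := by
  generalize hn : cs.length w = n
  induction n generalizing w with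
  | zero =>
    rw [cs.length_eq_zero_iff] at hn
    subst hn
    rw [bar_T, inv_one, T_one, Ring.inverse_one, sub_self]
    exact zero_mem _
  | succ n ih =>
    obtain ⟨i, hi⟩ := cs.exists_leftDescent_of_ne_one (w := w)
      (by rw [Ne, ← cs.length_eq_zero_iff]; omega)
    rw [cs.isLeftDescent_iff] at hi
    have h1 := bar_T_of_lt cs φ (i := i) (w := cs.simple i * w)
        (by rw [cs.simple_mul_simple_cancel_left]; omega)
    have h2 : T cs φ (cs.simple i) * T cs φ (cs.simple i * w) = T cs φ w := by
      rw [GHecke.T_simple_mul_T_of_lt, cs.simple_mul_simple_cancel_left]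
      rw [cs.simple_mul_simple_cancel_left]; omega
    rw [cs.simple_mul_simple_cancel_left, bar_T_simple] at h1
    have h3 := ih (cs.simple i * w) (by omega)
    set d := bar cs φ (T cs φ (cs.simple i * w)) - T cs φ (cs.simple i * w) with hd
    have h4 : bar cs φ (T cs φ (cs.simple i * w)) = T cs φ (cs.simple i * w) + d := by
      rw [hd]; abel
    rw [h1, h4, sub_mul, mul_add, h2, ← Algebra.smul_def]
    have h5 : T cs φ (cs.simple i * w) + d ∈ low cs φ (n + 1) :=
      add_mem (T_mem_low _ _ (by omega)) (low_mono cs φ (Nat.le_succ n) h3)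
    have h6 := sub_mem (simple_mul_low cs φ i h3)
      (Submodule.smul_mem _ (expo (φ (toSBar cs i)) - expo (-φ (toSBar cs i))) h5)
    convert h6 using 1
    abel

/-- Leading coefficients of a combination of a family that is unitriangular for the length. -/
theorem top_coeff (σ : AddMonoidAlgebra ℤ Γ →+ AddMonoidAlgebra ℤ Γ) (v : W → Hecke cs φ)
    (hv : ∀ w, v w - T cs φ w ∈ low cs φ (cs.length w)) (l : W →₀ AddMonoidAlgebra ℤ Γ) (w : W)
    (hl : ∀ y ∈ l.support, cs.length y ≤ cs.length w) :
    (stdBasis cs φ).repr (l.sum fun y a => σ a • v y) w = σ (l w) := by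
  classical
  rw [Finsupp.sum, map_sum, Finsupp.finsetSum_apply]
  have h : ∀ y ∈ l.support, (stdBasis cs φ).repr (σ (l y) • v y) w =
      if y = w then σ (l w) else 0 := by
    intro y hy
    have h1 := hv y w (hl y hy)
    rw [map_sub, Finsupp.sub_apply, sub_eq_zero, ← stdBasis_apply, Module.Basis.repr_self,
      Finsupp.single_apply] at h1
    rw [map_smul, Finsupp.smul_apply, h1]
    split_ifs with hyw
    · rw [hyw]; simp
    · simp
  rw [Finset.sum_congr rfl h, Finset.sum_ite_eq']
  split_ifs with hw
  · rfl
  · rw [Finsupp.notMem_support_iff.1 hw, map_zero]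

theorem exists_top (l : W →₀ AddMonoidAlgebra ℤ Γ) (hl : l ≠ 0) :
    ∃ w ∈ l.support, ∀ y ∈ l.support, cs.length y ≤ cs.length w :=
  Finset.exists_max_image l.support cs.length (Finsupp.support_nonempty_iff.2 hl)

/-- Existence of bar-invariant elements with leading term `T_w`. -/
theorem exists_bar_fixed (w : W) :
    ∃ h : Hecke cs φ, bar cs φ h = h ∧ h - T cs φ w ∈ low cs φ (cs.length w) := by
  generalize hn : cs.length w = n
  induction n generalizing w with
  | zero =>
    rw [cs.length_eq_zero_iff] at hn
    subst hn
    refine ⟨T cs φ 1, ?_, by simp⟩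
    rw [bar_T, inv_one, T_one, Ring.inverse_one]
  | succ n ih =>
    obtain ⟨i, hi⟩ := cs.exists_leftDescent_of_ne_one (w := w)
      (by rw [Ne, ← cs.length_eq_zero_iff]; omega)
    rw [cs.isLeftDescent_iff] at hi
    obtain ⟨k, hk, hk'⟩ := ih (cs.simple i * w) (by omega)
    have h2 : T cs φ (cs.simple i) * T cs φ (cs.simple i * w) = T cs φ w := by
      rw [GHecke.T_simple_mul_T_of_lt, cs.simple_mul_simple_cancel_left]
      rw [cs.simple_mul_simple_cancel_left]; omega
    refine ⟨T cs φ (cs.simple i) * k + expo (-φ (toSBar cs i)) • k, ?_, ?_⟩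
    · rw [bar_add, bar_smul, bar_T_simple_mul, hk, conj_expo, neg_neg, bar_T_simple, sub_mul,
        ← Algebra.smul_def, sub_smul]
      abel
    · set d := k - T cs φ (cs.simple i * w) with hd
      have h4 : k = T cs φ (cs.simple i * w) + d := by rw [hd]; abel
      have h5 : k ∈ low cs φ (n + 1) := by
        rw [h4]
        exact add_mem (T_mem_low _ _ (by omega)) (low_mono cs φ (Nat.le_succ n) hk')
      have h6 := add_mem (simple_mul_low cs φ i hk') (Submodule.smul_mem _
        (expo (-φ (toSBar cs i))) h5)
      convert h6 using 1
      rw [hd, mul_sub, h2]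
      abel

variable [LinearOrder Γ]

/-- `ℤ[Γ_{<0}]`, the elements of `ℤ[Γ]` supported on the negative elements of `Γ`. -/
def negPart (Γ : Type*) [AddCommGroup Γ] [LinearOrder Γ] : AddSubgroup (AddMonoidAlgebra ℤ Γ) where
  carrier := {a | ∀ γ, a.coeff γ ≠ 0 → γ < 0}
  add_mem' := fun {a b} ha hb γ h => by
    by_contra hc
    have h1 : a.coeff γ = 0 := by by_contra h1; exact hc (ha γ h1)
    have h2 : b.coeff γ = 0 := by by_contra h2; exact hc (hb γ h2)
    exact h (by simp [h1, h2])
  zero_mem' := fun γ h => absurd rfl h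
  neg_mem' := fun {a} ha γ h => ha γ (by simpa using h)

/-- `ℋ_{<0} = ⨁_w ℤ[Γ_{<0}] T_w`. -/
def negHecke : AddSubgroup (Hecke cs φ) where
  carrier := {h | ∀ w, (stdBasis cs φ).repr h w ∈ negPart Γ}
  add_mem' := fun {x y} hx hy w => by rw [map_add]; exact add_mem (hx w) (hy w)
  zero_mem' := fun w => by rw [map_zero]; exact zero_mem _
  neg_mem' := fun {x} hx w => by rw [map_neg]; exact neg_mem (hx w)

theorem smul_T_mem_negHecke {a : AddMonoidAlgebra ℤ Γ} (ha : a ∈ negPart Γ) (w : W) :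
    a • T cs φ w ∈ negHecke cs φ := by
  classical
  intro y
  rw [map_smul, ← stdBasis_apply, Module.Basis.repr_self, Finsupp.smul_apply, Finsupp.single_apply]
  split_ifs
  · simpa using ha
  · simp

variable [IsOrderedAddMonoid Γ]

theorem negPart_conj {a : AddMonoidAlgebra ℤ Γ} (ha : a ∈ negPart Γ) (hc : conj a = a) : a = 0 := by
  ext γ
  by_contra h
  have h1 : γ < 0 := ha γ h
  have h2 : (conj a).coeff (-γ) = a.coeff γ := by
    have : (conj a).coeff = Finsupp.mapDomain (fun x : Γ => -x) a.coeff := by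
      simp [conj]
    rw [this, Finsupp.mapDomain_apply neg_injective]
  rw [hc] at h2
  have h3 := ha (-γ) (by rw [h2]; exact h)
  have := neg_pos.2 h1
  exact lt_asymm h3 this

theorem exists_conj_fixed (a : AddMonoidAlgebra ℤ Γ) :
    ∃ m, conj m = m ∧ a - m ∈ negPart Γ := by
  have hs : ∀ (γ : Γ) (n : ℤ), γ < 0 → AddMonoidAlgebra.single γ n ∈ negPart Γ := by
    intro γ n hγ δ hδ
    by_contra hc
    apply hδ
    rw [AddMonoidAlgebra.coeff_single, Finsupp.single_apply, if_neg]
    rintro rfl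
    exact hc hγ
  induction a using AddMonoidAlgebra.induction_linear with
  | zero => exact ⟨0, map_zero _, by simp⟩
  | add x y hx hy =>
    obtain ⟨m, hm, h⟩ := hx
    obtain ⟨m', hm', h'⟩ := hy
    refine ⟨m + m', by rw [map_add, hm, hm'], ?_⟩
    rw [add_sub_add_comm]
    exact add_mem h h'
  | single γ n =>
    rcases lt_trichotomy γ 0 with h | h | h
    · exact ⟨0, map_zero _, by rw [sub_zero]; exact hs γ n h⟩
    · subst h
      exact ⟨AddMonoidAlgebra.single 0 n, by rw [conj_single, neg_zero], by simp⟩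
    · refine ⟨AddMonoidAlgebra.single γ n + AddMonoidAlgebra.single (-γ) n, ?_, ?_⟩
      · rw [map_add, conj_single, conj_single, neg_neg, add_comm]
      · rw [sub_add_cancel_left]
        exact neg_mem (hs _ _ (neg_lt_zero.2 h))

theorem correct (n : ℕ) (g : Hecke cs φ) (hg : g ∈ low cs φ n) :
    ∃ k ∈ low cs φ n, bar cs φ k = k ∧ g - k ∈ negHecke cs φ := by
  induction n generalizing g with
  | zero =>
    refine ⟨0, zero_mem _, bar_zero cs φ, ?_⟩
    have : g = 0 := by
      apply (stdBasis cs φ).repr.injective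
      ext1 w
      rw [map_zero]; exact hg w (Nat.zero_le _)
    rw [this, sub_zero]; exact zero_mem _
  | succ n ih =>
    refine low_induct cs φ (p := fun g => ∃ k ∈ low cs φ (n + 1),
      bar cs φ k = k ∧ g - k ∈ negHecke cs φ) hg ⟨0, zero_mem _, bar_zero cs φ, by simp⟩ ?_ fun w hw a => ?_
    · rintro x y ⟨k, h1, h2, h3⟩ ⟨k', h1', h2', h3'⟩
      refine ⟨k + k', add_mem h1 h1', by rw [bar_add, h2, h2'], ?_⟩
      rw [add_sub_add_comm]
      exact add_mem h3 h3'
    · obtain ⟨m, hm, hm'⟩ := exists_conj_fixed a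
      obtain ⟨p, hp, hp'⟩ := exists_bar_fixed cs φ w
      have hl : m • (p - T cs φ w) ∈ low cs φ n :=
        Submodule.smul_mem _ _ (low_mono cs φ (by omega) hp')
      obtain ⟨k, h1, h2, h3⟩ := ih _ hl
      refine ⟨m • p - k, ?_, ?_, ?_⟩
      · refine sub_mem (Submodule.smul_mem _ _ ?_) (low_mono cs φ (Nat.le_succ n) h1)
        have : p = T cs φ w + (p - T cs φ w) := by abel
        rw [this]
        exact add_mem (T_mem_low _ _ hw) (low_mono cs φ (by omega) hp')
      · rw [bar_sub, bar_smul, hm, hp, h2]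
      · have h4 := sub_mem (smul_T_mem_negHecke cs φ hm' w) h3
        convert h4 using 1
        rw [sub_smul, smul_sub]
        abel

theorem exists_kl (w : W) : ∃ c : Hecke cs φ, (bar cs φ c = c ∧ c - T cs φ w ∈ negHecke cs φ) ∧
    c - T cs φ w ∈ low cs φ (cs.length w) := by
  obtain ⟨p, hp, hp'⟩ := exists_bar_fixed cs φ w
  obtain ⟨k, h1, h2, h3⟩ := correct cs φ _ _ hp'
  refine ⟨p - k, ⟨by rw [bar_sub, hp, h2], ?_⟩, ?_⟩
  · rwa [sub_right_comm]
  · rw [sub_right_comm]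
    exact sub_mem hp' h1

theorem eq_zero_of_bar {h : Hecke cs φ} (hb : bar cs φ h = h) (hn : h ∈ negHecke cs φ) : h = 0 := by
  by_contra hne
  obtain ⟨w, hw, hmax⟩ := exists_top cs ((stdBasis cs φ).repr h)
    (fun h0 => hne ((stdBasis cs φ).repr.map_eq_zero_iff.1 h0))
  have h1 := top_coeff cs φ (conj (Γ := Γ)).toAddMonoidHom (fun w => Ring.inverse (T cs φ w⁻¹))
    (fun w => by rw [← bar_T]; exact bar_T_sub_mem cs φ w) ((stdBasis cs φ).repr h) w hmax
  have h2 : (stdBasis cs φ).repr (bar cs φ h) w = conj ((stdBasis cs φ).repr h w) := h1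
  rw [hb] at h2
  exact Finsupp.mem_support_iff.1 hw (negPart_conj (hn w) h2.symm)

theorem kl_unique {w : W} {c c' : Hecke cs φ}
    (h : bar cs φ c = c ∧ c - T cs φ w ∈ negHecke cs φ)
    (h' : bar cs φ c' = c' ∧ c' - T cs φ w ∈ negHecke cs φ) : c = c' := by
  rw [← sub_eq_zero]
  apply eq_zero_of_bar cs φ
  · rw [bar_sub, h.1, h'.1]
  · rw [← sub_sub_sub_cancel_right c c' (T cs φ w)]
    exact sub_mem h.2 h'.2

theorem existsUnique_kl (w : W) :
    ∃! c : Hecke cs φ, bar cs φ c = c ∧ c - T cs φ w ∈ negHecke cs φ := by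
  obtain ⟨c, hc, _⟩ := exists_kl cs φ w
  exact ⟨c, hc, fun c' hc' => kl_unique cs φ hc' hc⟩

/-- The Kazhdan-Lusztig element `C_w`: the unique bar-invariant element congruent to `T_w` modulo
`ℋ_{<0}`. -/
def C (w : W) : Hecke cs φ := (existsUnique_kl cs φ w).choose

theorem C_spec (w : W) :
    bar cs φ (C cs φ w) = C cs φ w ∧ C cs φ w - T cs φ w ∈ negHecke cs φ :=
  (existsUnique_kl cs φ w).choose_spec.1

theorem C_sub_T_mem_low (w : W) : C cs φ w - T cs φ w ∈ low cs φ (cs.length w) := by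
  obtain ⟨c, hc, h⟩ := exists_kl cs φ w
  rwa [kl_unique cs φ (C_spec cs φ w) hc]

theorem C_linearIndependent : LinearIndependent (AddMonoidAlgebra ℤ Γ) (C cs φ) := by
  rw [linearIndependent_iff]
  intro l hl
  by_contra hne
  obtain ⟨w, hw, hmax⟩ := exists_top cs l hne
  have h1 := top_coeff cs φ (AddMonoidHom.id _) (C cs φ) (C_sub_T_mem_low cs φ) l w hmax
  rw [Finsupp.linearCombination_apply] at hl
  have h2 : (stdBasis cs φ).repr (l.sum fun y a => a • C cs φ y) w = l w := h1
  rw [hl, map_zero] at h2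
  exact Finsupp.mem_support_iff.1 hw h2.symm

theorem C_span : (⊤ : Submodule (AddMonoidAlgebra ℤ Γ) (Hecke cs φ)) ≤
    Submodule.span _ (Set.range (C cs φ)) := by
  have h : ∀ n, low cs φ n ≤ Submodule.span _ (Set.range (C cs φ)) := by
    intro n
    induction n with
    | zero =>
      intro g hg
      exact low_induct cs φ hg (zero_mem _) (fun x y => add_mem) (fun w hw => by omega)
    | succ n ih =>
      intro g hg
      refine low_induct cs φ hg (zero_mem _) (fun x y => add_mem) (fun w hw a => ?_)
      refine Submodule.smul_mem _ _ ?_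
      have h1 : T cs φ w = C cs φ w - (C cs φ w - T cs φ w) := by abel
      rw [h1]
      exact sub_mem (Submodule.subset_span ⟨w, rfl⟩)
        (ih (low_mono cs φ (by omega) (C_sub_T_mem_low cs φ w)))
  intro g _
  refine induct cs φ g (zero_mem _) (fun x y => add_mem) fun w _ a => Submodule.smul_mem _ _ ?_
  exact h _ (T_mem_low cs φ (Nat.lt_succ_self (cs.length w)))

/-- The Kazhdan-Lusztig basis `(C_w)`. -/
def klBasis : Module.Basis W (AddMonoidAlgebra ℤ Γ) (Hecke cs φ) :=
  Module.Basis.mk (C_linearIndependent cs φ) (C_span cs φ)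

theorem klBasis_apply (w : W) : klBasis cs φ w = C cs φ w := Module.Basis.mk_apply _ _ w

end Hecke

end KL

/-! ## Cells -/

/-- The three kinds of cells: left (`L`), right (`R`) and two-sided (`LR`). -/
inductive Side
  | L
  | R
  | LR

/-- `L` or `LR`: the sides on which one can multiply on the left. -/
class Side.HasLeft (σ : Side) : Prop where
  out : σ = Side.L ∨ σ = Side.LR

/-- `R` or `LR`: the sides on which one can multiply on the right. -/
class Side.HasRight (σ : Side) : Prop where
  out : σ = Side.R ∨ σ = Side.LR

instance : Side.HasLeft Side.L := ⟨Or.inl rfl⟩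
instance : Side.HasLeft Side.LR := ⟨Or.inr rfl⟩
instance : Side.HasRight Side.R := ⟨Or.inl rfl⟩
instance : Side.HasRight Side.LR := ⟨Or.inr rfl⟩

section Cells

variable {B W : Type*} [Group W] {M : CoxeterMatrix B} {Γ : Type*} [AddCommGroup Γ] [LinearOrder Γ]
  [IsOrderedAddMonoid Γ] (cs : CoxeterSystem M W) (φ : SBar cs → Γ) (σ : Side)

/-- The relation `x ⟵ y`: the coefficient of `C_x` in `h C_y` (if `σ = L`), in `C_y h`
(if `σ = R`), in `h C_y` or in `C_y h` (if `σ = LR`) is non-zero for some `h`. -/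
def klStep (x y : W) : Prop :=
  match σ with
  | Side.L => ∃ h : Hecke cs φ, (Hecke.klBasis cs φ).repr (h * Hecke.C cs φ y) x ≠ 0
  | Side.R => ∃ h : Hecke cs φ, (Hecke.klBasis cs φ).repr (Hecke.C cs φ y * h) x ≠ 0
  | Side.LR => ∃ h : Hecke cs φ, (Hecke.klBasis cs φ).repr (h * Hecke.C cs φ y) x ≠ 0 ∨
      (Hecke.klBasis cs φ).repr (Hecke.C cs φ y * h) x ≠ 0

/-- The Kazhdan-Lusztig preorder: the transitive closure of `⟵`. -/
def klLE (x y : W) : Prop := Relation.TransGen (klStep cs φ σ) x y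

/-- The equivalence relation associated with the Kazhdan-Lusztig preorder. -/
def klEquiv (x y : W) : Prop := klLE cs φ σ x y ∧ klLE cs φ σ y x

/-- The cell of `w`. -/
def klCell (w : W) : Set W := {x | klEquiv cs φ σ x w}

variable {σ} in
theorem klStep_of_left [hσ : σ.HasLeft] {x y : W} (h : Hecke cs φ)
    (hx : (Hecke.klBasis cs φ).repr (h * Hecke.C cs φ y) x ≠ 0) : klStep cs φ σ x y := by
  rcases hσ.out with rfl | rfl
  · exact ⟨h, hx⟩
  · exact ⟨h, Or.inl hx⟩

variable {σ} in
theorem klStep_of_right [hσ : σ.HasRight] {x y : W} (h : Hecke cs φ)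
    (hx : (Hecke.klBasis cs φ).repr (Hecke.C cs φ y * h) x ≠ 0) : klStep cs φ σ x y := by
  rcases hσ.out with rfl | rfl
  · exact ⟨h, hx⟩
  · exact ⟨h, Or.inr hx⟩

/-! ### Cell modules -/

/-- The set of `x` with `x ≤ X`. -/
def lowerSet (X : Set W) : Set W := {x | ∃ c ∈ X, klLE cs φ σ x c}

/-- The set of `x` with `x < X` (for a cell `X`: `x ≤ X` and `x ∉ X`). -/
def strictLowerSet (X : Set W) : Set W := {x | ∃ c ∈ X, klLE cs φ σ x c ∧ ¬ klLE cs φ σ c x}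

/-- The `ℤ[Γ]`-span of the `C_x` with `x ∈ D`. -/
def spanC (D : Set W) : Submodule (AddMonoidAlgebra ℤ Γ) (Hecke cs φ) :=
  Submodule.span (AddMonoidAlgebra ℤ Γ) (Hecke.C cs φ '' D)

theorem lowerSet_closed (X : Set W) {x y : W} (h : klStep cs φ σ x y)
    (hy : y ∈ lowerSet cs φ σ X) : x ∈ lowerSet cs φ σ X := by
  obtain ⟨c, hc, hyc⟩ := hy
  exact ⟨c, hc, Relation.TransGen.head h hyc⟩

theorem strictLowerSet_closed (X : Set W) {x y : W} (h : klStep cs φ σ x y)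
    (hy : y ∈ strictLowerSet cs φ σ X) : x ∈ strictLowerSet cs φ σ X := by
  obtain ⟨c, hc, hyc, hcy⟩ := hy
  exact ⟨c, hc, Relation.TransGen.head h hyc, fun hcx => hcy (Relation.TransGen.tail hcx h)⟩

theorem mem_spanC_of_repr {D : Set W} (h : Hecke cs φ)
    (hD : ∀ x, (Hecke.klBasis cs φ).repr h x ≠ 0 → x ∈ D) : h ∈ spanC cs φ D := by
  rw [← (Hecke.klBasis cs φ).linearCombination_repr h, Finsupp.linearCombination_apply]
  refine Submodule.sum_mem _ fun x hx => Submodule.smul_mem _ _ (Submodule.subset_span ?_)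
  exact ⟨x, hD x (Finsupp.mem_support_iff.1 hx), (Hecke.klBasis_apply cs φ x).symm⟩

variable {σ} in
theorem spanC_mul_left [σ.HasLeft] {D : Set W}
    (hD : ∀ x y, klStep cs φ σ x y → y ∈ D → x ∈ D) (h : Hecke cs φ) :
    ∀ m ∈ spanC cs φ D, LinearMap.mulLeft (AddMonoidAlgebra ℤ Γ) h m ∈ spanC cs φ D := by
  intro m hm
  refine Submodule.span_le (p := (spanC cs φ D).comap (LinearMap.mulLeft _ h)).2 ?_ hm
  rintro _ ⟨y, hy, rfl⟩
  exact mem_spanC_of_repr cs φ _ fun x hx => hD x y (klStep_of_left cs φ h hx) hy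

variable {σ} in
theorem spanC_mul_right [σ.HasRight] {D : Set W}
    (hD : ∀ x y, klStep cs φ σ x y → y ∈ D → x ∈ D) (h : Hecke cs φ) :
    ∀ m ∈ spanC cs φ D, LinearMap.mulRight (AddMonoidAlgebra ℤ Γ) h m ∈ spanC cs φ D := by
  intro m hm
  refine Submodule.span_le (p := (spanC cs φ D).comap (LinearMap.mulRight _ h)).2 ?_ hm
  rintro _ ⟨y, hy, rfl⟩
  exact mem_spanC_of_repr cs φ _ fun x hx => hD x y (klStep_of_right cs φ h hx) hy

/-- The cell module `M_X = ℋ_{≤ X} / ℋ_{< X}`, as a `ℤ[Γ]`-module. -/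
abbrev CellModule (X : Set W) : Type _ :=
  spanC cs φ (lowerSet cs φ σ X) ⧸
    (spanC cs φ (strictLowerSet cs φ σ X)).submoduleOf (spanC cs φ (lowerSet cs φ σ X))

variable (X : Set W)

/-- Multiplication by `h` on the left of `M_X`. -/
def cellLeftMul [σ.HasLeft] (h : Hecke cs φ) :
    CellModule cs φ σ X →ₗ[AddMonoidAlgebra ℤ Γ] CellModule cs φ σ X :=
  Submodule.mapQ _ _
    ((LinearMap.mulLeft _ h).restrict (spanC_mul_left cs φ (fun _ _ => lowerSet_closed cs φ σ X) h))
    fun m hm => spanC_mul_left cs φ (fun _ _ => strictLowerSet_closed cs φ σ X) h m.1 hm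

/-- Multiplication by `h` on the right of `M_X`. -/
def cellRightMul [σ.HasRight] (h : Hecke cs φ) :
    CellModule cs φ σ X →ₗ[AddMonoidAlgebra ℤ Γ] CellModule cs φ σ X :=
  Submodule.mapQ _ _
    ((LinearMap.mulRight _ h).restrict
      (spanC_mul_right cs φ (fun _ _ => lowerSet_closed cs φ σ X) h))
    fun m hm => spanC_mul_right cs φ (fun _ _ => strictLowerSet_closed cs φ σ X) h m.1 hm

theorem cellLeftMul_mk [σ.HasLeft] (h : Hecke cs φ) (m : spanC cs φ (lowerSet cs φ σ X)) :
    cellLeftMul cs φ σ X h (Submodule.Quotient.mk m) = Submodule.Quotient.mk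
      ⟨h * m.1, spanC_mul_left cs φ (fun _ _ => lowerSet_closed cs φ σ X) h m.1 m.2⟩ := rfl

theorem cellRightMul_mk [σ.HasRight] (h : Hecke cs φ) (m : spanC cs φ (lowerSet cs φ σ X)) :
    cellRightMul cs φ σ X h (Submodule.Quotient.mk m) = Submodule.Quotient.mk
      ⟨m.1 * h, spanC_mul_right cs φ (fun _ _ => lowerSet_closed cs φ σ X) h m.1 m.2⟩ := rfl

/-- The left `ℋ`-module structure of `M_X` for `σ = L, LR`. -/
def cellLeft [σ.HasLeft] : Hecke cs φ →ₐ[AddMonoidAlgebra ℤ Γ]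
    Module.End (AddMonoidAlgebra ℤ Γ) (CellModule cs φ σ X) :=
  AlgHom.ofLinearMap
    { toFun := cellLeftMul cs φ σ X
      map_add' := fun x y => by
        refine LinearMap.ext fun m => ?_
        obtain ⟨m, rfl⟩ := Submodule.Quotient.mk_surjective _ m
        rw [LinearMap.add_apply, cellLeftMul_mk, cellLeftMul_mk, cellLeftMul_mk,
          ← Submodule.Quotient.mk_add]
        congr 1
        exact Subtype.ext (add_mul x y m.1)
      map_smul' := fun a x => by
        refine LinearMap.ext fun m => ?_
        obtain ⟨m, rfl⟩ := Submodule.Quotient.mk_surjective _ m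
        rw [RingHom.id_apply, LinearMap.smul_apply, cellLeftMul_mk, cellLeftMul_mk,
          ← Submodule.Quotient.mk_smul]
        congr 1
        exact Subtype.ext (smul_mul_assoc a x m.1) }
    (by
      refine LinearMap.ext fun m => ?_
      obtain ⟨m, rfl⟩ := Submodule.Quotient.mk_surjective _ m
      change cellLeftMul cs φ σ X 1 _ = Submodule.Quotient.mk m
      rw [cellLeftMul_mk]
      congr 1
      exact Subtype.ext (one_mul m.1))
    (fun x y => by
      refine LinearMap.ext fun m => ?_
      obtain ⟨m, rfl⟩ := Submodule.Quotient.mk_surjective _ m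
      change cellLeftMul cs φ σ X (x * y) (Submodule.Quotient.mk m) =
        cellLeftMul cs φ σ X x (cellLeftMul cs φ σ X y (Submodule.Quotient.mk m))
      rw [cellLeftMul_mk, cellLeftMul_mk, cellLeftMul_mk]
      congr 1
      exact Subtype.ext (mul_assoc x y m.1))

/-- The right `ℋ`-module structure of `M_X` for `σ = R, LR`. -/
def cellRight [σ.HasRight] : Hecke cs φ →ₐ[AddMonoidAlgebra ℤ Γ]
    (Module.End (AddMonoidAlgebra ℤ Γ) (CellModule cs φ σ X))ᵐᵒᵖ :=
  AlgHom.ofLinearMap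
    { toFun := fun h => MulOpposite.op (cellRightMul cs φ σ X h)
      map_add' := fun x y => by
        rw [← MulOpposite.op_add]
        congr 1
        refine LinearMap.ext fun m => ?_
        obtain ⟨m, rfl⟩ := Submodule.Quotient.mk_surjective _ m
        rw [LinearMap.add_apply, cellRightMul_mk, cellRightMul_mk, cellRightMul_mk,
          ← Submodule.Quotient.mk_add]
        congr 1
        exact Subtype.ext (mul_add m.1 x y)
      map_smul' := fun a x => by
        rw [RingHom.id_apply, ← MulOpposite.op_smul]
        congr 1
        refine LinearMap.ext fun m => ?_
        obtain ⟨m, rfl⟩ := Submodule.Quotient.mk_surjective _ m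
        rw [LinearMap.smul_apply, cellRightMul_mk, cellRightMul_mk, ← Submodule.Quotient.mk_smul]
        congr 1
        exact Subtype.ext (mul_smul_comm a m.1 x) }
    (by
      change MulOpposite.op _ = MulOpposite.op _
      congr 1
      refine LinearMap.ext fun m => ?_
      obtain ⟨m, rfl⟩ := Submodule.Quotient.mk_surjective _ m
      rw [cellRightMul_mk]
      change _ = Submodule.Quotient.mk m
      congr 1
      exact Subtype.ext (mul_one m.1))
    (fun x y => by
      change MulOpposite.op _ = MulOpposite.op _ * MulOpposite.op _
      rw [← MulOpposite.op_mul]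
      congr 1
      refine LinearMap.ext fun m => ?_
      obtain ⟨m, rfl⟩ := Submodule.Quotient.mk_surjective _ m
      change cellRightMul cs φ σ X (x * y) (Submodule.Quotient.mk m) =
        cellRightMul cs φ σ X y (cellRightMul cs φ σ X x (Submodule.Quotient.mk m))
      rw [cellRightMul_mk, cellRightMul_mk, cellRightMul_mk]
      congr 1
      exact Subtype.ext (mul_assoc m.1 x y).symm)

theorem cellLeft_apply [σ.HasLeft] (h : Hecke cs φ) :
    cellLeft cs φ σ X h = cellLeftMul cs φ σ X h := rfl

theorem cellRight_apply [σ.HasRight] (h : Hecke cs φ) :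
    cellRight cs φ σ X h = MulOpposite.op (cellRightMul cs φ σ X h) := rfl

theorem cellLeft_cellRight [σ.HasLeft] [σ.HasRight] (x y : Hecke cs φ) :
    cellLeftMul cs φ σ X x ∘ₗ cellRightMul cs φ σ X y =
      cellRightMul cs φ σ X y ∘ₗ cellLeftMul cs φ σ X x := by
  refine LinearMap.ext fun m => ?_
  obtain ⟨m, rfl⟩ := Submodule.Quotient.mk_surjective _ m
  rw [LinearMap.comp_apply, LinearMap.comp_apply, cellLeftMul_mk, cellRightMul_mk, cellRightMul_mk,
    cellLeftMul_mk]
  congr 1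
  exact Subtype.ext (mul_assoc x m.1 y).symm

end Cells

/-! ### Specialisation of cell modules along the augmentation -/

/-- The augmentation morphism `ℤ[Γ] → ℤ`, `e^γ ↦ 1`. -/
def aug (Γ : Type*) [AddCommGroup Γ] : AddMonoidAlgebra ℤ Γ →+* ℤ :=
  (AddMonoidAlgebra.lift ℤ ℤ Γ (1 : Multiplicative Γ →* ℤ)).toRingHom

theorem aug_expo {Γ : Type*} [AddCommGroup Γ] (γ : Γ) : aug Γ (expo γ) = 1 := by
  simp [aug, expo]

/-- The group `ℤ`, seen as a `ℤ[Γ]`-module through the augmentation. -/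
@[nolint unusedArguments]
def AugInt (Γ : Type*) [AddCommGroup Γ] : Type := ℤ

instance (Γ : Type*) [AddCommGroup Γ] : AddCommGroup (AugInt Γ) := inferInstanceAs (AddCommGroup ℤ)

instance (Γ : Type*) [AddCommGroup Γ] : Module (AddMonoidAlgebra ℤ Γ) (AugInt Γ) :=
  Module.compHom ℤ (aug Γ)

theorem augInt_smul {Γ : Type*} [AddCommGroup Γ] (a : AddMonoidAlgebra ℤ Γ) (n : AugInt Γ) :
    a • n = (show ℤ from aug Γ a * (show ℤ from n)) := rfl

section Specialise

variable {B W : Type*} [Group W] {M : CoxeterMatrix B} {A : Type*} [CommRing A]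

/-- An algebra morphism `ℋ → E` killing the parameters `u` factors through the group algebra of `W`:
`w` acts as `T_w`. -/
def specialise (cs : CoxeterSystem M W) (u : SBar cs → A) {E : Type*} [Ring E] [Algebra A E]
    (f : GHecke cs u →ₐ[A] E) (hf : ∀ ω, u ω • (1 : E) = 0) : W →* E where
  toFun w := f (GHecke.T cs u w)
  map_one' := by rw [GHecke.T_one, map_one]
  map_mul' := by
    have h0 : ∀ ω (e : E), u ω • e = 0 := fun ω e => by
      rw [← one_mul e, ← smul_mul_assoc, hf, zero_mul]
    have hs : ∀ i w, f (GHecke.T cs u (cs.simple i * w)) =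
        f (GHecke.T cs u (cs.simple i)) * f (GHecke.T cs u w) := by
      intro i w
      rw [← map_mul, GHecke.T_simple_mul_T, map_add, map_smul]
      split_ifs
      · rw [h0, add_zero]
      · rw [zero_smul, add_zero]
    intro x y
    induction x using cs.simple_induction_left with
    | one => rw [one_mul, GHecke.T_one, map_one, one_mul]
    | mul_simple_left w i ih => rw [mul_assoc, hs, ih, hs, mul_assoc]

end Specialise

open scoped TensorProduct in
/-- The specialised cell module `ℤ M_X = ℤ ⊗_{ℤ[Γ]} M_X`. -/
def IntCellModule {B W : Type*} [Group W] {M : CoxeterMatrix B} {Γ : Type*} [AddCommGroup Γ]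
    [LinearOrder Γ] [IsOrderedAddMonoid Γ] (cs : CoxeterSystem M W) (φ : SBar cs → Γ) (σ : Side)
    (X : Set W) : Type _ :=
  AugInt Γ ⊗[AddMonoidAlgebra ℤ Γ] CellModule cs φ σ X

section IntCell

variable {B W : Type*} [Group W] {M : CoxeterMatrix B} {Γ : Type*} [AddCommGroup Γ] [LinearOrder Γ]
  [IsOrderedAddMonoid Γ] (cs : CoxeterSystem M W) (φ : SBar cs → Γ) (σ : Side) (X : Set W)

open scoped TensorProduct

instance : AddCommGroup (IntCellModule cs φ σ X) :=
  inferInstanceAs (AddCommGroup (AugInt Γ ⊗[AddMonoidAlgebra ℤ Γ] CellModule cs φ σ X))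

instance : Module (AddMonoidAlgebra ℤ Γ) (IntCellModule cs φ σ X) :=
  inferInstanceAs (Module (AddMonoidAlgebra ℤ Γ)
    (AugInt Γ ⊗[AddMonoidAlgebra ℤ Γ] CellModule cs φ σ X))

/-- `f ↦ 1 ⊗ f`. -/
def tensorMap : Module.End (AddMonoidAlgebra ℤ Γ) (CellModule cs φ σ X) →ₐ[AddMonoidAlgebra ℤ Γ]
    Module.End (AddMonoidAlgebra ℤ Γ) (IntCellModule cs φ σ X) :=
  Module.End.lTensorAlgHom (AddMonoidAlgebra ℤ Γ) (CellModule cs φ σ X) (AugInt Γ)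

theorem param_smul (ω : SBar cs) (x : IntCellModule cs φ σ X) :
    (expo (φ ω) - expo (-φ ω)) • x = 0 := by
  have h : ∀ x : AugInt Γ ⊗[AddMonoidAlgebra ℤ Γ] CellModule cs φ σ X,
      (expo (φ ω) - expo (-φ ω)) • x = 0 := by
    intro x
    induction x using TensorProduct.induction_on with
    | zero => exact smul_zero _
    | tmul n m =>
      have h0 : (expo (φ ω) - expo (-φ ω)) • n = (0 : AugInt Γ) := by
        rw [augInt_smul, map_sub, aug_expo, aug_expo, sub_self, zero_mul]
        rfl
      rw [TensorProduct.smul_tmul', h0, TensorProduct.zero_tmul]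
    | add x y hx hy => rw [smul_add, hx, hy, add_zero]
  exact h x

/-- `w` acts on `ℤ M_X` on the left as `1 ⊗ T_w`. -/
def intCellLeft [σ.HasLeft] :
    W →* Module.End (AddMonoidAlgebra ℤ Γ) (IntCellModule cs φ σ X) :=
  specialise cs _ ((tensorMap cs φ σ X).comp (cellLeft cs φ σ X))
    fun ω => LinearMap.ext fun x => param_smul cs φ σ X ω x

/-- `w` acts on `ℤ M_X` on the right as `1 ⊗ T_w`. -/
def intCellRight [σ.HasRight] :
    W →* (Module.End (AddMonoidAlgebra ℤ Γ) (IntCellModule cs φ σ X))ᵐᵒᵖ :=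
  specialise cs _ ((AlgHom.op (tensorMap cs φ σ X)).comp (cellRight cs φ σ X))
    fun ω => congrArg MulOpposite.op (LinearMap.ext fun x => param_smul cs φ σ X ω x)

/-- The left `ℤ W`-module structure of `ℤ M_X` for `σ = L, LR`. -/
instance [σ.HasLeft] : Module (MonoidAlgebra ℤ W) (IntCellModule cs φ σ X) :=
  Module.compHom _ (MonoidAlgebra.lift ℤ _ W (intCellLeft cs φ σ X)).toRingHom

/-- The right `ℤ W`-module structure of `ℤ M_X` for `σ = R, LR`. -/
instance [σ.HasRight] : Module (MonoidAlgebra ℤ W)ᵐᵒᵖ (IntCellModule cs φ σ X) :=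
  Module.compHom _ ((RingEquiv.opOp _).symm.toRingHom.comp
    (RingHom.op (MonoidAlgebra.lift ℤ _ W (intCellRight cs φ σ X)).toRingHom))

theorem single_smul [σ.HasLeft] (w : W) (n : AugInt Γ) (m : CellModule cs φ σ X) :
    MonoidAlgebra.single w (1 : ℤ) • (show IntCellModule cs φ σ X from n ⊗ₜ m) =
      (show IntCellModule cs φ σ X from n ⊗ₜ cellLeftMul cs φ σ X (Hecke.T cs φ w) m) := by
  change (MonoidAlgebra.lift ℤ _ W (intCellLeft cs φ σ X)) (MonoidAlgebra.single w (1 : ℤ)) _ = _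
  rw [MonoidAlgebra.lift_single, one_smul]
  rfl

theorem single_op_smul [σ.HasRight] (w : W) (n : AugInt Γ) (m : CellModule cs φ σ X) :
    MulOpposite.op (MonoidAlgebra.single w (1 : ℤ)) •
        (show IntCellModule cs φ σ X from n ⊗ₜ m) =
      (show IntCellModule cs φ σ X from n ⊗ₜ cellRightMul cs φ σ X (Hecke.T cs φ w) m) := by
  change ((MonoidAlgebra.lift ℤ _ W (intCellRight cs φ σ X))
    (MonoidAlgebra.single w (1 : ℤ))).unop _ = _
  rw [MonoidAlgebra.lift_single, one_smul]
  rfl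

/-- For `σ = LR`, the two structures make `ℤ M_X` a bimodule. -/
instance [σ.HasLeft] [σ.HasRight] :
    SMulCommClass (MonoidAlgebra ℤ W) (MonoidAlgebra ℤ W)ᵐᵒᵖ (IntCellModule cs φ σ X) where
  smul_comm a b x := by
    have hw : ∀ w w' : W, Commute (intCellLeft cs φ σ X w) (intCellRight cs φ σ X w').unop := by
      intro w w'
      change tensorMap cs φ σ X (cellLeftMul cs φ σ X (Hecke.T cs φ w)) *
          tensorMap cs φ σ X (cellRightMul cs φ σ X (Hecke.T cs φ w')) =
        tensorMap cs φ σ X (cellRightMul cs φ σ X (Hecke.T cs φ w')) *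
          tensorMap cs φ σ X (cellLeftMul cs φ σ X (Hecke.T cs φ w))
      rw [← map_mul, ← map_mul]
      exact congrArg _ (cellLeft_cellRight cs φ σ X _ _)
    have h : ∀ a b : MonoidAlgebra ℤ W,
        Commute (MonoidAlgebra.lift ℤ _ W (intCellLeft cs φ σ X) a)
          (MonoidAlgebra.lift ℤ _ W (intCellRight cs φ σ X) b).unop := by
      intro a b
      induction a using MonoidAlgebra.induction_linear with
      | zero => rw [map_zero]; exact Commute.zero_left _
      | add a a' ha ha' => rw [map_add]; exact ha.add_left ha'
      | single w n =>
        induction b using MonoidAlgebra.induction_linear with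
        | zero => rw [map_zero]; exact Commute.zero_right _
        | add b b' hb hb' => rw [map_add]; exact hb.add_right hb'
        | single w' n' =>
          rw [MonoidAlgebra.lift_single, MonoidAlgebra.lift_single, MulOpposite.unop_smul]
          exact ((hw w w').smul_left n).smul_right n'
    exact LinearMap.congr_fun (h a b.unop) x

end IntCell

/-! ## Positive subsets -/

/-- A positive subset `X` of an abelian group: `Λ = X ∪ (-X)`, `X + X ⊆ X`, and `X ∩ (-X)` is
a subgroup. -/
@[ext]
structure PositiveSubset (Λ : Type*) [AddCommGroup Λ] where
  carrier : Set Λ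
  total : ∀ x, x ∈ carrier ∨ -x ∈ carrier
  add_mem : ∀ x ∈ carrier, ∀ y ∈ carrier, x + y ∈ carrier
  inter_neg : ∃ H : AddSubgroup Λ, ∀ x, x ∈ H ↔ x ∈ carrier ∧ -x ∈ carrier

namespace PositiveSubset

variable {Λ : Type*} [AddCommGroup Λ]

/-- The positive subset `Pos(f) = {x | f x ≥ 0}` of a morphism to a totally ordered group. -/
def pos {Γ : Type*} [AddCommGroup Γ] [LinearOrder Γ] [IsOrderedAddMonoid Γ] (f : Λ →+ Γ) :
    PositiveSubset Λ where
  carrier := {x | 0 ≤ f x}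
  total x := by
    simp only [Set.mem_ofPred_eq, map_neg, Left.nonneg_neg_iff]
    exact le_total _ _
  add_mem x hx y hy := by
    simp only [Set.mem_ofPred_eq, map_add] at *
    exact add_nonneg hx hy
  inter_neg := ⟨f.ker, fun x => by
    simp only [AddMonoidHom.mem_ker, Set.mem_ofPred_eq, map_neg, Left.nonneg_neg_iff]
    exact ⟨fun h => ⟨h.ge, h.le⟩, fun h => le_antisymm h.2 h.1⟩⟩

variable (X : PositiveSubset Λ)

theorem zero_mem : (0 : Λ) ∈ X.carrier := by
  have := X.total 0
  rwa [neg_zero, or_self] at this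

/-- The subgroup `X ∩ (-X)`. -/
def core : AddSubgroup Λ where
  carrier := {x | x ∈ X.carrier ∧ -x ∈ X.carrier}
  zero_mem' := ⟨X.zero_mem, by rw [neg_zero]; exact X.zero_mem⟩
  add_mem' := fun {x y} hx hy => ⟨X.add_mem _ hx.1 _ hy.1, by
    rw [neg_add]; exact X.add_mem _ hx.2 _ hy.2⟩
  neg_mem' := fun {x} hx => ⟨hx.2, by rw [neg_neg]; exact hx.1⟩

/-- The group `Λ / (X ∩ (-X))`. -/
def Quo : Type _ := Λ ⧸ X.core

instance : AddCommGroup X.Quo := inferInstanceAs (AddCommGroup (Λ ⧸ X.core))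

/-- The canonical morphism `Λ → Λ / (X ∩ (-X))`. -/
def can : Λ →+ X.Quo := QuotientAddGroup.mk' X.core

theorem can_eq_zero {x : Λ} : X.can x = 0 ↔ x ∈ X.carrier ∧ -x ∈ X.carrier :=
  QuotientAddGroup.eq_zero_iff x

theorem can_surjective : Function.Surjective X.can := QuotientAddGroup.mk'_surjective X.core

open scoped Classical in
/-- The order on `Λ / (X ∩ (-X))`: `a ≤ b` if some representative of `b - a` belongs to `X`. -/
instance : LinearOrder X.Quo where
  le a b := ∃ x ∈ X.carrier, X.can x = b - a
  le_refl a := ⟨0, X.zero_mem, by rw [map_zero, sub_self]⟩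
  le_trans a b c := by
    rintro ⟨x, hx, h⟩ ⟨y, hy, h'⟩
    exact ⟨x + y, X.add_mem _ hx _ hy, by rw [map_add, h, h']; abel⟩
  le_antisymm a b := by
    rintro ⟨x, hx, h⟩ ⟨y, hy, h'⟩
    have h1 : X.can (x + y) = 0 := by rw [map_add, h, h']; abel
    have h2 := X.add_mem _ (X.can_eq_zero.1 h1).2 _ hy
    have h3 : X.can x = 0 := X.can_eq_zero.2 ⟨hx, by
      rwa [show -(x + y) + y = -x by abel] at h2⟩
    rw [h3, eq_comm, sub_eq_zero] at h
    exact h.symm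
  le_total a b := by
    obtain ⟨x, hx⟩ := X.can_surjective (b - a)
    rcases X.total x with h | h
    · exact Or.inl ⟨x, h, hx⟩
    · exact Or.inr ⟨-x, h, by rw [map_neg, hx, neg_sub]⟩
  toDecidableLE := Classical.decRel _

theorem le_def (a b : X.Quo) : a ≤ b ↔ ∃ x ∈ X.carrier, X.can x = b - a := Iff.rfl

instance : IsOrderedAddMonoid X.Quo where
  add_le_add_left a b h c := by
    rw [le_def] at h ⊢
    obtain ⟨x, hx, h⟩ := h
    exact ⟨x, hx, by rw [h]; abel⟩

end PositiveSubset

section Weights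

variable {S Γ : Type*} [AddCommGroup Γ]

/-- The extension of `φ : S → Γ` to a morphism of groups `ℤ[S] → Γ`. -/
def extend (φ : S → Γ) : (S →₀ ℤ) →+ Γ :=
  Finsupp.liftAddHom fun s => zmultiplesHom Γ (φ s)

theorem extend_single (φ : S → Γ) (s : S) : extend φ (Finsupp.single s 1) = φ s := by
  simp [extend]

/-- The canonical map `φ_X : S → ℤ[S] / (X ∩ (-X))`. -/
def canWeight (X : PositiveSubset (S →₀ ℤ)) (s : S) : X.Quo := X.can (Finsupp.single s 1)

end Weights

end KLCells

end

/-!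
Put `X = Pos(φ)`. The subgroup `X ∩ -X` is the kernel of the extension of `φ` to `ℤ[S̄]`, so `Γ_X`
embeds into `Γ` as an ordered group, by a map `ι` with `φ = ι ∘ φ_X`. Extension of scalars along
`e^γ ↦ e^(ι γ)` is multiplicative on Hecke algebras, fixes the `T_w`, commutes with the bar
involution and, as `ι` is strictly increasing, preserves coefficients in negative degrees. The
uniqueness of the Kazhdan–Lusztig basis then shows that it sends `C_w` to `C_w`. As `ι` is
injective, no coefficient in the basis `(C_w)` becomes zero, so the preorders agree. Finally `e^γ`
and `e^(ι γ)` have the same augmentation, so matching the classes of the `C_w` identifies the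
actions of the `T_w` on the specialised cell modules.
-/

noncomputable section

namespace KLCells

open Module TensorProduct

section Bases

variable {κ R R' M M' N N' : Type*}

section Semilinear

variable [Semiring R] [Semiring R'] [AddCommMonoid M] [AddCommMonoid M'] [AddCommMonoid N]
  [Module R M] [Module R' M'] [Module R N]

theorem exists_apply_ne_zero_iff_exists_basis (b : Basis κ R M) (g : M →ₗ[R] N) :
    (∃ m, g m ≠ 0) ↔ ∃ i, g (b i) ≠ 0 := by
  refine ⟨fun h => ?_, fun ⟨i, hi⟩ => ⟨b i, hi⟩⟩
  contrapose! h
  exact LinearMap.congr_fun (b.ext (f₂ := 0) h)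

theorem repr_apply_of_apply_basis {f : R →+* R'} {F : M →ₛₗ[f] M'} {b : Basis κ R M}
    {b' : Basis κ R' M'} (hF : ∀ i, F (b i) = b' i) (m : M) (i : κ) :
    b'.repr (F m) i = f (b.repr m i) := by
  classical
  have h : (Finsupp.lapply i ∘ₗ b'.repr.toLinearMap).comp F =
      f.toSemilinearMap.comp (Finsupp.lapply i ∘ₗ b.repr.toLinearMap) :=
    b.ext fun j => by simp [hF, Finsupp.single_apply, apply_ite f]
  exact LinearMap.congr_fun h m

end Semilinear

section Subquotient

variable [Ring R] [AddCommGroup M] [Module R M] (b : Basis κ R M) {D : Set κ} (E : Set κ)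
  {P Q : Submodule R M} (hP : P = Submodule.span R (b '' D)) (hQ : Q = Submodule.span R (b '' E))
include hP

theorem subtypeDomain_repr_surjective : Function.Surjective
    (Finsupp.lsubtypeDomain (R := R) (D \ E) ∘ₗ b.repr.toLinearMap ∘ₗ P.subtype) := by
  classical
  intro c
  have hc : ↑(c.extendDomain).support ⊆ D := fun x hx =>
    (Finsupp.support_extendDomain_subset c hx).1
  refine ⟨⟨b.repr.symm c.extendDomain, ?_⟩, ?_⟩
  · rwa [hP, b.mem_span_image, b.repr.apply_symm_apply]
  · exact (congrArg _ (b.repr.apply_symm_apply _)).trans (Finsupp.subtypeDomain_extendDomain c)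

variable {E}
include hQ

theorem ker_subtypeDomain_repr :
    LinearMap.ker (Finsupp.lsubtypeDomain (R := R) (D \ E) ∘ₗ b.repr.toLinearMap ∘ₗ P.subtype) =
      Q.submoduleOf P := by
  ext ⟨m, hm⟩
  have hD : ↑(b.repr m).support ⊆ D := b.mem_span_image.1 (hP ▸ hm)
  rw [LinearMap.mem_ker, Submodule.submoduleOf, Submodule.mem_comap, Submodule.subtype_apply, hQ,
    b.mem_span_image]
  refine ⟨fun h x hx => ?_, fun h => Finsupp.ext fun x => ?_⟩
  · by_contra hxE
    exact Finsupp.mem_support_iff.1 hx (DFunLike.congr_fun h (⟨x, hD hx, hxE⟩ : ↥(D \ E)))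
  · exact by_contra fun hx => x.2.2 (h (Finsupp.mem_support_iff.2 hx))

/-- The basis of a subquotient `P / Q` of a free module with basis `b`, where `P` and `Q` are
spanned by the `b i` with `i ∈ D` and with `i ∈ E`. It consists of the classes of the `b i` with
`i ∈ D \ E`. -/
def subquotientBasis : Basis ↥(D \ E) R (P ⧸ Q.submoduleOf P) :=
  Basis.ofRepr <| (Submodule.quotEquivOfEq _ _ (ker_subtypeDomain_repr b hP hQ).symm).trans
    (LinearMap.quotKerEquivOfSurjective _ (subtypeDomain_repr_surjective b E hP))

theorem subquotientBasis_repr_mk (m : P) (x : ↥(D \ E)) :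
    (subquotientBasis b hP hQ).repr (Submodule.Quotient.mk m) x = b.repr m x := rfl

end Subquotient

section Tensor

variable [CommSemiring R] [CommSemiring R'] [AddCommMonoid M] [AddCommMonoid M']
  [AddCommMonoid N] [AddCommMonoid N'] [Module R M] [Module R' M'] [Module R N] [Module R' N']

open scoped Classical in
/-- The isomorphism `N ⊗ M ≃ N' ⊗ M'` sending `n ⊗ b i` to `g n ⊗ b' i`, where `b` and `b'` are
bases of `M` and `M'` with the same index set. The two tensor products may be over different
rings. -/
def tensorEquivOfBasis (b : Basis κ R M) (b' : Basis κ R' M') (g : N ≃+ N') :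
    N ⊗[R] M ≃+ N' ⊗[R'] M' :=
  (equivFinsuppOfBasisRight b).toAddEquiv.trans <|
    (Finsupp.mapRange.addEquiv g).trans (equivFinsuppOfBasisRight b').symm.toAddEquiv

theorem tensorEquivOfBasis_tmul {f : R →+* R'} {F : M →ₛₗ[f] M'} {b : Basis κ R M}
    {b' : Basis κ R' M'} (hF : ∀ m i, b'.repr (F m) i = f (b.repr m i)) {g : N ≃+ N'}
    (hg : ∀ (r : R) (n : N), g (r • n) = f r • g n) (n : N) (m : M) :
    tensorEquivOfBasis b b' g (n ⊗ₜ m) = g n ⊗ₜ F m := by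
  classical
  rw [tensorEquivOfBasis, AddEquiv.trans_apply, AddEquiv.trans_apply]
  refine (LinearEquiv.symm_apply_eq _).2 (Finsupp.ext fun i => ?_)
  simp [hF, hg]

end Tensor

end Bases

namespace GHecke

variable {B W : Type*} [Group W] {M : CoxeterMatrix B} (cs : CoxeterSystem M W)
  {A A' : Type*} [CommRing A] [CommRing A']

theorem T_mem_adjoin_simple (u : SBar cs → A) (w : W) :
    T cs u w ∈ Algebra.adjoin A (Set.range fun i => T cs u (cs.simple i)) := by
  induction w using cs.simple_induction_left with
  | one => exact one_mem _
  | mul_simple_left w i hw =>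
    rw [← sub_eq_of_eq_add (T_simple_mul_T cs u i w)]
    exact sub_mem (mul_mem (Algebra.subset_adjoin ⟨i, rfl⟩) hw) (Subalgebra.smul_mem _ hw _)

theorem adjoin_T_simple (u : SBar cs → A) :
    Algebra.adjoin A (Set.range fun i => T cs u (cs.simple i)) = ⊤ := by
  rw [← Algebra.toSubmodule_eq_top, ← top_le_iff, ← (basis cs u).span_eq, Submodule.span_le]
  rintro _ ⟨w, rfl⟩
  exact T_mem_adjoin_simple cs u w

variable (f : A →+* A') {u : SBar cs → A} {u' : SBar cs → A'}

/-- The semilinear map between Hecke algebras fixing the `T_w`, obtained by applying `f` to the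
coefficients. -/
def baseChange (u : SBar cs → A) (u' : SBar cs → A') : GHecke cs u →ₛₗ[f] GHecke cs u' :=
  (basis cs u').repr.symm.toLinearMap.comp <|
    (Finsupp.mapRange.linearMap f.toSemilinearMap).comp (basis cs u).repr.toLinearMap

theorem baseChange_T (w : W) : baseChange cs f u u' (T cs u w) = T cs u' w := by
  simp [baseChange, T]

variable {f} (hu : ∀ ω, f (u ω) = u' ω)
include hu

theorem baseChange_T_simple_mul (i : B) (x : GHecke cs u) :
    baseChange cs f u u' (T cs u (cs.simple i) * x) =
      T cs u' (cs.simple i) * baseChange cs f u u' x := by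
  have h : (baseChange cs f u u').comp (LinearMap.mulLeft A (T cs u (cs.simple i))) =
      (LinearMap.mulLeft A' (T cs u' (cs.simple i))).comp (baseChange cs f u u') :=
    (basis cs u).ext fun w => by
      change baseChange cs f u u' (T cs u (cs.simple i) * T cs u w) =
        T cs u' (cs.simple i) * baseChange cs f u u' (T cs u w)
      rw [baseChange_T, T_simple_mul_T, T_simple_mul_T, map_add, map_smulₛₗ, baseChange_T,
        baseChange_T, apply_ite f, hu, map_zero]
  exact LinearMap.congr_fun h x

theorem baseChange_mul (x y : GHecke cs u) :
    baseChange cs f u u' (x * y) = baseChange cs f u u' x * baseChange cs f u u' y := by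
  have hx : x ∈ Algebra.adjoin A (Set.range fun i => T cs u (cs.simple i)) :=
    adjoin_T_simple cs u ▸ Algebra.mem_top
  induction hx using Algebra.adjoin_induction generalizing y with
  | mem x hx =>
    obtain ⟨i, rfl⟩ := hx
    simp only [baseChange_T_simple_mul cs hu, baseChange_T]
  | algebraMap a =>
    rw [Algebra.algebraMap_eq_smul_one, smul_one_mul, map_smulₛₗ, map_smulₛₗ, ← T_one, baseChange_T,
      T_one, smul_one_mul]
  | add x x' _ _ hx hx' => rw [add_mul, map_add, map_add, add_mul, hx, hx']
  | mul x x' _ _ hx hx' => rw [mul_assoc, hx, hx', hx, mul_assoc]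

end GHecke

section ExpMap

variable {Γ Γ' : Type*} [AddCommGroup Γ] [AddCommGroup Γ'] (ι : Γ →+ Γ')

/-- The ring morphism `ℤ[Γ] → ℤ[Γ']` with `e^γ ↦ e^(ι γ)`. -/
abbrev expMap : AddMonoidAlgebra ℤ Γ →+* AddMonoidAlgebra ℤ Γ' :=
  AddMonoidAlgebra.mapDomainRingHom ℤ ι

theorem expMap_single (γ : Γ) (n : ℤ) :
    expMap ι (AddMonoidAlgebra.single γ n) = AddMonoidAlgebra.single (ι γ) n := by
  simp [expMap]

theorem expMap_expo (γ : Γ) : expMap ι (expo γ) = expo (ι γ) := expMap_single ι γ 1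

theorem expMap_injective {ι : Γ →+ Γ'} (hι : Function.Injective ι) :
    Function.Injective (expMap ι) :=
  AddMonoidAlgebra.mapDomain_injective hι

theorem expMap_conj (a : AddMonoidAlgebra ℤ Γ) : expMap ι (conj a) = conj (expMap ι a) := by
  induction a using AddMonoidAlgebra.induction_linear with
  | zero => simp only [map_zero]
  | add x y hx hy => simp only [map_add, hx, hy]
  | single γ n => rw [conj_single, expMap_single, expMap_single, conj_single, map_neg]

theorem aug_expMap (a : AddMonoidAlgebra ℤ Γ) : aug Γ' (expMap ι a) = aug Γ a := by
  induction a using AddMonoidAlgebra.induction_linear with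
  | zero => simp only [map_zero]
  | add x y hx hy => simp only [map_add, hx, hy]
  | single γ n => simp [aug]

theorem expMap_mem_negPart [LinearOrder Γ] [LinearOrder Γ'] {ι : Γ →+ Γ'} (hι : StrictMono ι)
    {a : AddMonoidAlgebra ℤ Γ} (ha : a ∈ Hecke.negPart Γ) :
    expMap ι a ∈ Hecke.negPart Γ' := by
  classical
  intro γ hγ
  have hsupp : γ ∈ (Finsupp.mapDomain ι a.coeff).support := by
    simpa [expMap, Finsupp.mem_support_iff] using hγ
  obtain ⟨δ, hδ, rfl⟩ := Finset.mem_image.1 (Finsupp.mapDomain_support hsupp)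
  rw [← map_zero ι]
  exact hι (ha δ (Finsupp.mem_support_iff.1 hδ))

end ExpMap

section WeightChange

variable {B W : Type*} [Group W] {M : CoxeterMatrix B} (cs : CoxeterSystem M W)
  {Γ Γ' : Type*} [AddCommGroup Γ] [AddCommGroup Γ'] (ι : Γ →+ Γ') (φ : SBar cs → Γ)

namespace Hecke

/-- Extension of scalars along `e^γ ↦ e^(ι γ)` from the Hecke algebra with weights `φ` to the one
with weights `ι ∘ φ`, as a semilinear map. -/
abbrev baseChange : Hecke cs φ →ₛₗ[expMap ι] Hecke cs (ι ∘ φ) :=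
  GHecke.baseChange cs (expMap ι) _ _

theorem baseChange_T (w : W) : baseChange cs ι φ (T cs φ w) = T cs (ι ∘ φ) w :=
  GHecke.baseChange_T cs (expMap ι) w

theorem baseChange_mul (x y : Hecke cs φ) :
    baseChange cs ι φ (x * y) = baseChange cs ι φ x * baseChange cs ι φ y :=
  GHecke.baseChange_mul cs
    (fun ω => by simp only [map_sub, expMap_expo, map_neg, Function.comp_apply]) x y

theorem baseChange_inverse_T (w : W) :
    baseChange cs ι φ (Ring.inverse (T cs φ w)) = Ring.inverse (T cs (ι ∘ φ) w) := by
  refine (isUnit_T cs (ι ∘ φ) w).mul_left_cancel ?_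
  rw [Ring.mul_inverse_cancel _ (isUnit_T cs (ι ∘ φ) w), ← baseChange_T, ← baseChange_mul,
    Ring.mul_inverse_cancel _ (isUnit_T cs φ w)]
  exact baseChange_T cs ι φ 1

theorem baseChange_bar (x : Hecke cs φ) :
    baseChange cs ι φ (bar cs φ x) = bar cs (ι ∘ φ) (baseChange cs ι φ x) := by
  induction x using Hecke.induct with
  | h0 => rw [bar_zero, map_zero, bar_zero]
  | hadd x y hx hy => rw [bar_add, map_add, map_add, bar_add, hx, hy]
  | hT w _ a =>
    rw [bar_smul, map_smulₛₗ, map_smulₛₗ, bar_smul, expMap_conj, baseChange_T, bar_T, bar_T,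
      baseChange_inverse_T]

variable [LinearOrder Γ] [LinearOrder Γ'] [IsOrderedAddMonoid Γ] [IsOrderedAddMonoid Γ']
  {ι : Γ →+ Γ'} (hι : StrictMono ι)
include hι

theorem baseChange_C (w : W) : baseChange cs ι φ (C cs φ w) = C cs (ι ∘ φ) w := by
  refine kl_unique cs (ι ∘ φ) ⟨?_, fun y => ?_⟩ (C_spec cs (ι ∘ φ) w)
  · rw [← baseChange_bar, (C_spec cs φ w).1]
  · rw [← baseChange_T, ← map_sub,
      repr_apply_of_apply_basis (b := stdBasis cs φ) (baseChange_T cs ι φ)]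
    exact expMap_mem_negPart hι ((C_spec cs φ w).2 y)

theorem klBasis_repr_baseChange (x : Hecke cs φ) (w : W) :
    (klBasis cs (ι ∘ φ)).repr (baseChange cs ι φ x) w = expMap ι ((klBasis cs φ).repr x w) :=
  repr_apply_of_apply_basis
    (fun w => by rw [klBasis_apply, klBasis_apply, baseChange_C cs φ hι]) x w

theorem klBasis_repr_baseChange_ne_zero (x : Hecke cs φ) (w : W) :
    (klBasis cs (ι ∘ φ)).repr (baseChange cs ι φ x) w ≠ 0 ↔ (klBasis cs φ).repr x w ≠ 0 := by
  rw [klBasis_repr_baseChange cs φ hι, map_ne_zero_iff _ (expMap_injective hι.injective)]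

end Hecke

variable [LinearOrder Γ] [LinearOrder Γ'] [IsOrderedAddMonoid Γ] [IsOrderedAddMonoid Γ']

theorem exists_repr_mul_C_ne_zero_iff (x y : W) :
    (∃ h : Hecke cs φ, (Hecke.klBasis cs φ).repr (h * Hecke.C cs φ y) x ≠ 0) ↔
      ∃ w, (Hecke.klBasis cs φ).repr (Hecke.T cs φ w * Hecke.C cs φ y) x ≠ 0 :=
  exists_apply_ne_zero_iff_exists_basis (Hecke.stdBasis cs φ)
    ((Hecke.klBasis cs φ).coord x ∘ₗ LinearMap.mulRight _ (Hecke.C cs φ y))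

theorem exists_repr_C_mul_ne_zero_iff (x y : W) :
    (∃ h : Hecke cs φ, (Hecke.klBasis cs φ).repr (Hecke.C cs φ y * h) x ≠ 0) ↔
      ∃ w, (Hecke.klBasis cs φ).repr (Hecke.C cs φ y * Hecke.T cs φ w) x ≠ 0 :=
  exists_apply_ne_zero_iff_exists_basis (Hecke.stdBasis cs φ)
    ((Hecke.klBasis cs φ).coord x ∘ₗ LinearMap.mulLeft _ (Hecke.C cs φ y))

variable {ι : Γ →+ Γ'} (hι : StrictMono ι) (σ : Side)
include hι

theorem klStep_comp : klStep cs (ι ∘ φ) σ = klStep cs φ σ := by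
  ext x y
  have hleft (w : W) := Hecke.klBasis_repr_baseChange_ne_zero cs φ hι
    (Hecke.T cs φ w * Hecke.C cs φ y) x
  have hright (w : W) := Hecke.klBasis_repr_baseChange_ne_zero cs φ hι
    (Hecke.C cs φ y * Hecke.T cs φ w) x
  simp only [Hecke.baseChange_mul, Hecke.baseChange_T, Hecke.baseChange_C cs φ hι] at hleft hright
  cases σ <;>
    simp only [klStep, exists_or, exists_repr_mul_C_ne_zero_iff, exists_repr_C_mul_ne_zero_iff,
      hleft, hright]

theorem klLE_comp : klLE cs (ι ∘ φ) σ = klLE cs φ σ := by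
  ext x y
  rw [klLE, klLE, klStep_comp cs φ hι]

theorem klEquiv_comp : klEquiv cs (ι ∘ φ) σ = klEquiv cs φ σ := by
  ext x y
  rw [klEquiv, klEquiv, klLE_comp cs φ hι]

theorem klCell_comp : klCell cs (ι ∘ φ) σ = klCell cs φ σ := by
  ext w x
  rw [klCell, klCell, klEquiv_comp cs φ hι]

theorem lowerSet_comp (X : Set W) : lowerSet cs (ι ∘ φ) σ X = lowerSet cs φ σ X := by
  rw [lowerSet, lowerSet, klLE_comp cs φ hι]

theorem strictLowerSet_comp (X : Set W) :
    strictLowerSet cs (ι ∘ φ) σ X = strictLowerSet cs φ σ X := by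
  rw [strictLowerSet, strictLowerSet, klLE_comp cs φ hι]

theorem baseChange_mem_spanC {D : Set W} {x : Hecke cs φ} (hx : x ∈ spanC cs φ D) :
    Hecke.baseChange cs ι φ x ∈ spanC cs (ι ∘ φ) D := by
  suffices h : spanC cs φ D ≤ (spanC cs (ι ∘ φ) D).comap (Hecke.baseChange cs ι φ) from h hx
  refine Submodule.span_le.2 ?_
  rintro _ ⟨w, hw, rfl⟩
  exact Submodule.subset_span ⟨w, hw, (Hecke.baseChange_C cs φ hι w).symm⟩

theorem baseChange_mem_spanC_lowerSet (X : Set W) (x : Hecke cs φ)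
    (hx : x ∈ spanC cs φ (lowerSet cs φ σ X)) :
    Hecke.baseChange cs ι φ x ∈ spanC cs (ι ∘ φ) (lowerSet cs (ι ∘ φ) σ X) :=
  lowerSet_comp cs φ hι σ X ▸ baseChange_mem_spanC cs φ hι hx

theorem baseChange_mem_spanC_strictLowerSet (X : Set W) (x : Hecke cs φ)
    (hx : x ∈ spanC cs φ (strictLowerSet cs φ σ X)) :
    Hecke.baseChange cs ι φ x ∈ spanC cs (ι ∘ φ) (strictLowerSet cs (ι ∘ φ) σ X) :=
  strictLowerSet_comp cs φ hι σ X ▸ baseChange_mem_spanC cs φ hι hx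

/-- The map between cell modules induced by extension of scalars along `e^γ ↦ e^(ι γ)`. -/
def cellBaseChange (X : Set W) : CellModule cs φ σ X →ₛₗ[expMap ι] CellModule cs (ι ∘ φ) σ X :=
  Submodule.mapQ _ _
    ((Hecke.baseChange cs ι φ).restrict (baseChange_mem_spanC_lowerSet cs φ hι σ X))
    fun m hm => baseChange_mem_spanC_strictLowerSet cs φ hι σ X m.1 hm

theorem cellBaseChange_cellLeftMul [σ.HasLeft] (X : Set W) (w : W) (m : CellModule cs φ σ X) :
    cellBaseChange cs φ hι σ X (cellLeftMul cs φ σ X (Hecke.T cs φ w) m) =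
      cellLeftMul cs (ι ∘ φ) σ X (Hecke.T cs (ι ∘ φ) w) (cellBaseChange cs φ hι σ X m) := by
  induction m using Submodule.Quotient.induction_on with | H m
  refine congrArg Submodule.Quotient.mk (Subtype.ext ?_)
  exact (Hecke.baseChange_mul cs ι φ _ _).trans (congrArg (· * _) (Hecke.baseChange_T cs ι φ w))

theorem cellBaseChange_cellRightMul [σ.HasRight] (X : Set W) (w : W) (m : CellModule cs φ σ X) :
    cellBaseChange cs φ hι σ X (cellRightMul cs φ σ X (Hecke.T cs φ w) m) =
      cellRightMul cs (ι ∘ φ) σ X (Hecke.T cs (ι ∘ φ) w) (cellBaseChange cs φ hι σ X m) := by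
  induction m using Submodule.Quotient.induction_on with | H m
  refine congrArg Submodule.Quotient.mk (Subtype.ext ?_)
  exact (Hecke.baseChange_mul cs ι φ _ _).trans (congrArg (_ * ·) (Hecke.baseChange_T cs ι φ w))

omit hι in
theorem spanC_eq_span_klBasis (D : Set W) :
    spanC cs φ D = Submodule.span _ (Hecke.klBasis cs φ '' D) := by
  rw [spanC, funext (Hecke.klBasis_apply cs φ)]

omit hι in
/-- The basis of a cell module consisting of the classes of the `C_x` with `x ≤ X` and not `x < X`.
The index set is described by `D` and `E` so that it can be chosen independently of the weights. -/
def cellBasis {X D E : Set W} (hD : lowerSet cs φ σ X = D) (hE : strictLowerSet cs φ σ X = E) :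
    Basis ↥(D \ E) (AddMonoidAlgebra ℤ Γ) (CellModule cs φ σ X) :=
  subquotientBasis (Hecke.klBasis cs φ) (hD ▸ spanC_eq_span_klBasis cs φ _)
    (hE ▸ spanC_eq_span_klBasis cs φ _)

theorem cellBasis_repr_cellBaseChange {X D E : Set W} (hD : lowerSet cs φ σ X = D)
    (hE : strictLowerSet cs φ σ X = E) (hD' : lowerSet cs (ι ∘ φ) σ X = D)
    (hE' : strictLowerSet cs (ι ∘ φ) σ X = E) (m : CellModule cs φ σ X) (x : ↥(D \ E)) :
    (cellBasis cs (ι ∘ φ) σ hD' hE').repr (cellBaseChange cs φ hι σ X m) x =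
      expMap ι ((cellBasis cs φ σ hD hE).repr m x) := by
  induction m using Submodule.Quotient.induction_on with | H m
  refine (subquotientBasis_repr_mk ..).trans ?_
  rw [cellBasis, subquotientBasis_repr_mk]
  exact Hecke.klBasis_repr_baseChange cs φ hι m x

/-- The isomorphism between cell modules specialised along the augmentation, sending the class of
`C_x` to the class of `C_x`. -/
def intCellEquiv (X : Set W) : IntCellModule cs φ σ X ≃+ IntCellModule cs (ι ∘ φ) σ X :=
  tensorEquivOfBasis (cellBasis cs φ σ rfl rfl)
    (cellBasis cs (ι ∘ φ) σ (lowerSet_comp cs φ hι σ X) (strictLowerSet_comp cs φ hι σ X))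
    (AddEquiv.refl ℤ : AugInt Γ ≃+ AugInt Γ')

omit hι in
variable {cs φ σ} in
theorem intCell_induction {X : Set W} {p : IntCellModule cs φ σ X → Prop} (zero : p 0)
    (tmul : ∀ (n : AugInt Γ) (m : CellModule cs φ σ X), p (n ⊗ₜ m))
    (add : ∀ x y, p x → p y → p (x + y)) (x : IntCellModule cs φ σ X) : p x :=
  TensorProduct.induction_on (motive := p) x zero tmul add

theorem intCellEquiv_tmul (X : Set W) (n : AugInt Γ) (m : CellModule cs φ σ X) :
    intCellEquiv cs φ hι σ X (show IntCellModule cs φ σ X from n ⊗ₜ m) =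
      (show IntCellModule cs (ι ∘ φ) σ X from
        (show AugInt Γ' from n) ⊗ₜ cellBaseChange cs φ hι σ X m) :=
  tensorEquivOfBasis_tmul (cellBasis_repr_cellBaseChange cs φ hι σ rfl rfl _ _)
    (fun a n => by
      rw [augInt_smul, augInt_smul, aug_expMap]
      rfl) n m

theorem intCellEquiv_single_smul [σ.HasLeft] (X : Set W) (w : W) (m : IntCellModule cs φ σ X) :
    intCellEquiv cs φ hι σ X (MonoidAlgebra.single w (1 : ℤ) • m) =
      MonoidAlgebra.single w (1 : ℤ) • intCellEquiv cs φ hι σ X m := by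
  induction m using intCell_induction with
  | zero => rw [smul_zero, map_zero, smul_zero]
  | add m m' hm hm' => rw [smul_add, map_add, map_add, smul_add, hm, hm']
  | tmul n m =>
    rw [single_smul, intCellEquiv_tmul, intCellEquiv_tmul, single_smul, cellBaseChange_cellLeftMul]

theorem intCellEquiv_single_op_smul [σ.HasRight] (X : Set W) (w : W)
    (m : IntCellModule cs φ σ X) :
    intCellEquiv cs φ hι σ X (MulOpposite.op (MonoidAlgebra.single w (1 : ℤ)) • m) =
      MulOpposite.op (MonoidAlgebra.single w (1 : ℤ)) • intCellEquiv cs φ hι σ X m := by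
  induction m using intCell_induction with
  | zero => rw [smul_zero, map_zero, smul_zero]
  | add m m' hm hm' => rw [smul_add, map_add, map_add, smul_add, hm, hm']
  | tmul n m =>
    rw [single_op_smul, intCellEquiv_tmul, intCellEquiv_tmul, single_op_smul,
      cellBaseChange_cellRightMul]

theorem intCellEquiv_smul [σ.HasLeft] (X : Set W) (a : MonoidAlgebra ℤ W)
    (m : IntCellModule cs φ σ X) :
    intCellEquiv cs φ hι σ X (a • m) = a • intCellEquiv cs φ hι σ X m := by
  induction a using MonoidAlgebra.induction_linear with
  | zero => rw [zero_smul, zero_smul, map_zero]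
  | add a b ha hb => rw [add_smul, add_smul, map_add, ha, hb]
  | single w n =>
    rw [← mul_one n, ← smul_eq_mul, ← MonoidAlgebra.smul_single, smul_assoc, smul_assoc, map_zsmul,
      intCellEquiv_single_smul]

theorem intCellEquiv_op_smul [σ.HasRight] (X : Set W) (a : (MonoidAlgebra ℤ W)ᵐᵒᵖ)
    (m : IntCellModule cs φ σ X) :
    intCellEquiv cs φ hι σ X (a • m) = a • intCellEquiv cs φ hι σ X m := by
  induction a using MulOpposite.rec' with | h a
  induction a using MonoidAlgebra.induction_linear with
  | zero => rw [MulOpposite.op_zero, zero_smul, zero_smul, map_zero]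
  | add a b ha hb => rw [MulOpposite.op_add, add_smul, add_smul, map_add, ha, hb]
  | single w n =>
    rw [← mul_one n, ← smul_eq_mul, ← MonoidAlgebra.smul_single, MulOpposite.op_smul, smul_assoc,
      smul_assoc, map_zsmul, intCellEquiv_single_op_smul]

end WeightChange

section Positive

namespace PositiveSubset

variable {Λ : Type*} [AddCommGroup Λ] (X : PositiveSubset Λ)

theorem can_nonneg_iff (x : Λ) : 0 ≤ X.can x ↔ x ∈ X.carrier := by
  rw [le_def, sub_zero]
  refine ⟨fun ⟨y, hy, hyx⟩ => ?_, fun hx => ⟨x, hx, rfl⟩⟩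
  have hker : X.can (x - y) = 0 := by rw [map_sub, hyx, sub_self]
  exact add_sub_cancel y x ▸ X.add_mem y hy _ (X.can_eq_zero.1 hker).1

theorem pos_can : pos X.can = X :=
  PositiveSubset.ext (Set.ext X.can_nonneg_iff)

variable {X} {Γ : Type*} [AddCommGroup Γ] [LinearOrder Γ] [IsOrderedAddMonoid Γ]

theorem exists_strictMono_comp_can {f : Λ →+ Γ} (hX : pos f = X) :
    ∃ ι : X.Quo →+ Γ, StrictMono ι ∧ ι.comp X.can = f := by
  subst hX
  have hker : (pos f).core ≤ f.ker := fun x hx => by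
    have hneg : 0 ≤ f (-x) := hx.2
    exact le_antisymm (neg_nonneg.1 (map_neg f x ▸ hneg)) hx.1
  refine ⟨QuotientAddGroup.lift _ f hker, ?_, AddMonoidHom.ext fun x => rfl⟩
  refine (strictMono_iff_map_pos _).2 fun a ha => ?_
  obtain ⟨x, rfl⟩ := (pos f).can_surjective a
  refine lt_of_le_of_ne ((pos f).can_nonneg_iff x |>.1 ha.le) fun hx => ha.ne' ?_
  have hneg : 0 ≤ f (-x) := by rw [map_neg]; exact neg_nonneg.2 hx.ge
  exact (pos f).can_eq_zero.2 ⟨hx.le, hneg⟩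

end PositiveSubset

variable {S : Type*}

theorem extend_canWeight (X : PositiveSubset (S →₀ ℤ)) : extend (canWeight X) = X.can :=
  Finsupp.addHom_ext' fun s => AddMonoidHom.ext_int (extend_single _ s)

theorem pos_extend_canWeight (X : PositiveSubset (S →₀ ℤ)) :
    PositiveSubset.pos (extend (canWeight X)) = X := by
  rw [extend_canWeight, PositiveSubset.pos_can]

theorem exists_strictMono_comp_canWeight {Γ : Type*} [AddCommGroup Γ] [LinearOrder Γ]
    [IsOrderedAddMonoid Γ] {φ : S → Γ} {X : PositiveSubset (S →₀ ℤ)}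
    (hX : PositiveSubset.pos (extend φ) = X) :
    ∃ ι : X.Quo →+ Γ, StrictMono ι ∧ φ = ι ∘ canWeight X := by
  obtain ⟨ι, hι, hcomp⟩ := PositiveSubset.exists_strictMono_comp_can hX
  refine ⟨ι, hι, funext fun s => ?_⟩
  rw [← extend_single φ s, ← hcomp]
  rfl

end Positive

end KLCells

end

open KLCells in
theorem mainTheorem7_general {B W : Type*} [Group W] {M : CoxeterMatrix B} (cs : CoxeterSystem M W)
    {Γ Γ' : Type*} [AddCommGroup Γ] [LinearOrder Γ] [IsOrderedAddMonoid Γ]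
    [AddCommGroup Γ'] [LinearOrder Γ'] [IsOrderedAddMonoid Γ']
    (φ : SBar cs → Γ) (φ' : SBar cs → Γ')
    (h : PositiveSubset.pos (extend φ) = PositiveSubset.pos (extend φ')) (σ : Side) :
    klLE cs φ σ = klLE cs φ' σ ∧
    klEquiv cs φ σ = klEquiv cs φ' σ ∧
    klCell cs φ σ = klCell cs φ' σ ∧
    ∀ C : Set W, ∃ e : IntCellModule cs φ σ C ≃+ IntCellModule cs φ' σ C,
      (∀ [σ.HasLeft] (a : MonoidAlgebra ℤ W) (m : IntCellModule cs φ σ C),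
        e (a • m) = a • e m) ∧
      (∀ [σ.HasRight] (a : (MonoidAlgebra ℤ W)ᵐᵒᵖ) (m : IntCellModule cs φ σ C),
        e (a • m) = a • e m) := by
  obtain ⟨ι, hι, hφ⟩ := exists_strictMono_comp_canWeight h
  obtain ⟨ι', hι', hφ'⟩ := exists_strictMono_comp_canWeight (φ := φ') rfl
  generalize PositiveSubset.pos (extend φ') = X at *
  subst hφ hφ'
  refine ⟨?_, ?_, ?_, fun C => ?_⟩
  · rw [klLE_comp cs _ hι, klLE_comp cs _ hι']
  · rw [klEquiv_comp cs _ hι, klEquiv_comp cs _ hι']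
  · rw [klCell_comp cs _ hι, klCell_comp cs _ hι']
  · refine ⟨(intCellEquiv cs _ hι σ C).symm.trans (intCellEquiv cs _ hι' σ C), ?_, ?_⟩
    · intro _ a m
      obtain ⟨n, rfl⟩ := (intCellEquiv cs _ hι σ C).surjective m
      simp only [AddEquiv.trans_apply, ← intCellEquiv_smul, AddEquiv.symm_apply_apply]
    · intro _ a m
      obtain ⟨n, rfl⟩ := (intCellEquiv cs _ hι σ C).surjective m
      simp only [AddEquiv.trans_apply, ← intCellEquiv_op_smul, AddEquiv.symm_apply_apply]

theorem mainTheorem7 {B W : Type*} [Group W] {M : CoxeterMatrix B} (cs : CoxeterSystem M W)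
    {Γ : Type*} [AddCommGroup Γ] [LinearOrder Γ] [IsOrderedAddMonoid Γ] (φ : KLCells.SBar cs → Γ)
    (X : KLCells.PositiveSubset (KLCells.SBar cs →₀ ℤ))
    (hX : X = KLCells.PositiveSubset.pos (KLCells.extend φ)) :
    (∀ (σ : KLCells.Side) (x y : W),
      KLCells.klLE cs φ σ x y ↔ KLCells.klLE cs (KLCells.canWeight X) σ x y) ∧
    (∀ (σ : KLCells.Side) (x y : W),
      KLCells.klEquiv cs φ σ x y ↔ KLCells.klEquiv cs (KLCells.canWeight X) σ x y) ∧
    (∀ (σ : KLCells.Side) (w : W),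
      KLCells.klCell cs φ σ w = KLCells.klCell cs (KLCells.canWeight X) σ w) ∧
    (∀ (Γ' : Type*) [AddCommGroup Γ'] [LinearOrder Γ'] [IsOrderedAddMonoid Γ']
      (φ' : KLCells.SBar cs → Γ'), KLCells.PositiveSubset.pos (KLCells.extend φ') = X →
      ∀ σ : KLCells.Side,
        (∀ x y : W, KLCells.klLE cs φ' σ x y ↔ KLCells.klLE cs φ σ x y) ∧
        (∀ x y : W, KLCells.klEquiv cs φ' σ x y ↔ KLCells.klEquiv cs φ σ x y) ∧
        (∀ w : W, KLCells.klCell cs φ' σ w = KLCells.klCell cs φ σ w)) ∧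
    (∀ (w : W) (C : Set W), C = KLCells.klCell cs φ .L w →
      Nonempty (KLCells.IntCellModule cs φ .L C ≃ₗ[MonoidAlgebra ℤ W]
        KLCells.IntCellModule cs (KLCells.canWeight X) .L C)) ∧
    (∀ (w : W) (C : Set W), C = KLCells.klCell cs φ .R w →
      Nonempty (KLCells.IntCellModule cs φ .R C ≃ₗ[(MonoidAlgebra ℤ W)ᵐᵒᵖ]
        KLCells.IntCellModule cs (KLCells.canWeight X) .R C)) ∧
    (∀ (w : W) (C : Set W), C = KLCells.klCell cs φ .LR w →
      ∃ e : KLCells.IntCellModule cs φ .LR C ≃+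
          KLCells.IntCellModule cs (KLCells.canWeight X) .LR C,
        (∀ (a : MonoidAlgebra ℤ W) (m : KLCells.IntCellModule cs φ .LR C),
          e (a • m) = a • e m) ∧
        (∀ (a : (MonoidAlgebra ℤ W)ᵐᵒᵖ) (m : KLCells.IntCellModule cs φ .LR C),
          e (a • m) = a • e m)) := by
  have h := mainTheorem7_general cs φ (KLCells.canWeight X)
    (hX.symm.trans (KLCells.pos_extend_canWeight X).symm)
  refine ⟨fun σ x y => by rw [(h σ).1], fun σ x y => by rw [(h σ).2.1],
    fun σ w => by rw [(h σ).2.2.1], fun Γ' _ _ _ φ' hφ' σ => ?_, fun w C _ => ?_, fun w C _ => ?_,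
    fun w C _ => ?_⟩
  · obtain ⟨hLE, hEquiv, hCell, -⟩ := mainTheorem7_general cs φ' φ (hφ'.trans hX) σ
    rw [hLE, hEquiv, hCell]
    exact ⟨fun _ _ => .rfl, fun _ _ => .rfl, fun _ => rfl⟩
  · obtain ⟨e, he, -⟩ := (h .L).2.2.2 C
    exact ⟨{ e with map_smul' := he }⟩
  · obtain ⟨e, -, he⟩ := (h .R).2.2.2 C
    exact ⟨{ e with map_smul' := he }⟩
  · obtain ⟨e, hl, hr⟩ := (h .LR).2.2.2 C
    exact ⟨e, hl, hr⟩
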